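/- Let $r\ge 1$ be an integer and $T\in\mathbb C^*$. Let $R:\widehat{\mathbb C}\to\widehat{\mathbb C}$ be a rational function of degree $r$, let $\Psi(z)=R(e^{2\pi i z/T})$, a meromorphic function $\mathbb C\to\widehat{\mathbb C}$, and let $X=f(z)\,\frac{\partial}{\partial z}$ with $f=1/\Psi'$ be the associated vector field. Put $a_0=R(0)$ and $a_\infty=R(\infty)$. Terminology. Let $D(a,\rho)$ be the disk of radius $\rho>0$ about $a\in\widehat{\mathbb C}$ in the spherical metric. A *transcendental singularity of $\Psi^{-1}$ over $a$* is a choice $U=(U(\rho))_{\rho>0}$ of a connected component $U(\rho)$ of $\Psi^{-1}(D(a,\rho))$ for each $\rho>0$ such that $U(\rho_1)\subset U(\rho_2)$ for $\rho_1<\rho_2$ and $\bigcap_{\rho>0}U(\rho)=\varnothing$. It is *logarithmic* if $\Psi:U(\rho)\to D(a,\rho)\setminus\{a\}$ is a universal covering for some $\rho>0$. An *asymptotic value* of $\Psi$ is a limit of $\Psi$ along a path tending to $\infty$. An open set $W\subset\mathbb C$ is a *hyperbolic* (resp. *elliptic*) *tract* of $X$ if, for some $c\in\mathbb R$, there is a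 biholomorphism of $W$ onto $\{\operatorname{Re}\zeta>c\}$ (resp. $\{\operatorname{Re}\zeta<c\}$) that maps $X$ to $e^{\zeta}\frac{\partial}{\partial\zeta}$. The residue of $X$ at a zero is the residue of the 1-form $dz/f(z)$. A critical point of $R$ is a point of $\widehat{\mathbb C}$ at which $R$ is not locally injective. Then: 1. $X$ is periodic of period $T$ (that is, $f(z+T)=f(z)$), and $\infty$ is the unique essential (not necessarily isolated) singularity of $X$ on $\widehat{\mathbb C}$, i.e. the unique point at which $X$ is not meromorphic. 2. The set of asymptotic values of $\Psi$ is $\{a_0,a_\infty\}$. Counted with multiplicity there are exactly two: $\Psi^{-1}$ has exactly two transcendental singularities, which are different, one over $a_0$ and one over $a_\infty$ (also when $a_0=a_\infty$). 3. Both transcendental singularities are logarithmic. Let $U$ be one of them, over $a$. - (i) If $a\in\mathbb C$, the tracts are hyperbolic: for all sufficiently small $\rho$ there is a biholomorphism of $U(\rho)$ onto $\{\zeta\in\mathbb C: a-e^{-\zeta}\in D(a,\rho)\}$ that maps $X$ to $e^\zeta\frac{\partial}{\partial\zeta}$; and for every $\rho>0$ there are $\rho'>0$ and a hyperbolic tract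 $W$ of $X$ with $U(\rho')\subset W\subset U(\rho)$. - (ii) If $a=\infty$, then $U(\rho)$ is an elliptic tract of $X$ for all sufficiently small $\rho$. 4. If $R$ has a critical point in $\widehat{\mathbb C}\setminus\{0,\infty\}$ whose critical value is finite, then $X$ has infinitely many poles, accumulating at $\infty$. 5. If $\infty$ is not an asymptotic value of $\Psi$, then $X$ has infinitely many zeros of multiplicity at least $2$ and residue zero, accumulating at $\infty$. More precisely, each pole of $R$ of order $m$ then gives rise to infinitely many zeros of $X$ of multiplicity exactly $m+1$ and residue zero, accumulating at $\infty$; in particular these are double zeros if $R$ has a simple pole. 6. The family of the rational functions $R$ of degree $r$, with its topology as a subset of $\mathbb{CP}^{2r+1}$ (coefficients of numerator and denominator up to a common factor), is the disjoint union of the four subfamilies - (i) $a_0,a_\infty,\infty$ are three distinct points; - (ii) $a_0=a_\infty\neq\infty$; - (iii) exactly one of $a_0,a_\infty$ is $\infty$; - (iv) $a_0=a_\infty=\infty$; and subfamily (i) is generic, i.e. open and dense. (Some of the subfamilies may be empty, as (ii) and (iv) are for $r=1$.) -/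

import Mathlib

open Filter Topology Set OnePoint

noncomputable section

namespace PeriodicFields

/-! ### The Riemann sphere and rational functions -/

/-- The Riemann sphere. -/
abbrev Sphere : Type := OnePoint ℂ

/-- The spherical (great circle) distance on the Riemann sphere. -/
def sphericalDist : Sphere → Sphere → ℝ
  | ∞, ∞ => 0
  | ∞, (z : ℂ) => 2 * Real.arcsin (1 / √(1 + ‖z‖ ^ 2))
  | (z : ℂ), ∞ => 2 * Real.arcsin (1 / √(1 + ‖z‖ ^ 2))
  | (z : ℂ), (w : ℂ) => 2 * Real.arcsin (‖z - w‖ / (√(1 + ‖z‖ ^ 2) * √(1 + ‖w‖ ^ 2)))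

/-- The open disk `D(a, ρ)` in the spherical metric. -/
def sphericalDisk (a : Sphere) (ρ : ℝ) : Set Sphere := {b | sphericalDist a b < ρ}

/-- The affine coordinate of a point of the sphere, with the value `0` at `∞`. -/
def affine : Sphere → ℂ
  | ∞ => 0
  | (z : ℂ) => z

/-- The map of the Riemann sphere to itself defined by a rational function
(`num` and `denom` are coprime). -/
def ratMap (R : RatFunc ℂ) : Sphere → Sphere
  | ∞ => if R.denom.natDegree < R.num.natDegree then ∞
      else ((R.num.coeff R.denom.natDegree / R.denom.leadingCoeff : ℂ) : Sphere)
  | (w : ℂ) => if R.denom.eval w = 0 then ∞ else ((R.num.eval w / R.denom.eval w : ℂ) : Sphere)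

/-- The degree of a rational function as a self-map of the sphere. -/
def ratDegree (R : RatFunc ℂ) : ℕ := max R.num.natDegree R.denom.natDegree

/-- The set of rational functions of degree `r`. -/
def RatMaps (r : ℕ) : Type := {R : RatFunc ℂ // ratDegree R = r}

/-- The polynomial `c₀ + c₁ w + ⋯ + c_r w ^ r`. -/
def coeffPoly {r : ℕ} (c : Fin (r + 1) → ℂ) : Polynomial ℂ :=
  ∑ i : Fin (r + 1), Polynomial.monomial (i : ℕ) (c i)

/-- The quotient of two polynomials given by their coefficients. -/
def coeffQuot {r : ℕ} (c : (Fin (r + 1) → ℂ) × (Fin (r + 1) → ℂ)) : RatFunc ℂ :=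
  algebraMap (Polynomial ℂ) (RatFunc ℂ) (coeffPoly c.1) /
    algebraMap (Polynomial ℂ) (RatFunc ℂ) (coeffPoly c.2)

/-- Homogeneous coordinates of the rational functions of degree `r`: the coefficient vectors
in `ℂ ^ (2 r + 2)` of numerator and denominator. -/
def RatCoeffs (r : ℕ) : Type :=
  {c : (Fin (r + 1) → ℂ) × (Fin (r + 1) → ℂ) // coeffPoly c.2 ≠ 0 ∧ ratDegree (coeffQuot c) = r}

/-- The rational functions of degree `r` are topologized as the quotient of the space of
coefficient vectors by scaling, that is, as a subset of the projective space of dimension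
`2 r + 1`. -/
instance (r : ℕ) : TopologicalSpace (RatMaps r) :=
  TopologicalSpace.coinduced (fun c : RatCoeffs r => (⟨coeffQuot c.1, c.2.2⟩ : RatMaps r))
    (instTopologicalSpaceSubtype : TopologicalSpace (RatCoeffs r))

/-! ### Functions and vector fields -/

/-- The function `Ψ(z) = R(exp(2 π i z / T))`. -/
def psi (R : RatFunc ℂ) (T : ℂ) : ℂ → Sphere := fun z =>
  ratMap R ((Complex.exp (2 * Real.pi * Complex.I * z / T) : ℂ) : Sphere)

/-- The coefficient `f = 1 / Ψ'` of the vector field `X = f(z) ∂/∂z` associated with `Ψ`.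
It is a meromorphic function; its value at its poles, and at the poles of `Ψ`, is `0`. -/
def field (Ψ : ℂ → Sphere) : ℂ → ℂ := fun z => (deriv (fun ζ => affine (Ψ ζ)) z)⁻¹

/-- The vector field `f(z) ∂/∂z` on the sphere has an essential (not necessarily isolated)
singularity at a point if it is not meromorphic there. In the coordinate `w = 1 / z` the vector
field is `- w ^ 2 f(1 / w) ∂/∂w`. -/
def IsEssentialSingularity (f : ℂ → ℂ) : Sphere → Prop
  | ∞ => ¬ MeromorphicAt (fun w => - w ^ 2 * f w⁻¹) 0
  | (z : ℂ) => ¬ MeromorphicAt f z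

/-- The poles of the vector field `f(z) ∂/∂z` in the plane. -/
def poles (f : ℂ → ℂ) : Set ℂ := {z | meromorphicOrderAt f z < 0}

/-- `g(z) dz` has residue `c` at `z₀`. -/
def HasResidue (g : ℂ → ℂ) (z₀ c : ℂ) : Prop :=
  ∀ᶠ ε in 𝓝[>] (0 : ℝ), (2 * Real.pi * Complex.I)⁻¹ * (∮ z in C(z₀, ε), g z) = c

/-- The zeros of multiplicity `k` of the vector field `f(z) ∂/∂z` in the plane at which the
1-form of time `dz / f(z)` has residue zero. -/
def residueFreeZeros (f : ℂ → ℂ) (k : ℕ) : Set ℂ :=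
  {z | meromorphicOrderAt f z = ((k : ℤ) : WithTop ℤ) ∧ HasResidue (fun ζ => (f ζ)⁻¹) z 0}

/-- Every neighborhood of `∞` contains infinitely many points of `S`. -/
def AccumulatesAtInfty (S : Set ℂ) : Prop := ∀ K : ℝ, {z ∈ S | K < ‖z‖}.Infinite

/-- A point of the plane is critical for a sphere-valued meromorphic function if the derivative
vanishes there at a finite value, or if it is a multiple pole. -/
def IsCriticalPoint (F : ℂ → Sphere) (w : ℂ) : Prop :=
  (F w ≠ ∞ ∧ deriv (fun ζ => affine (F ζ)) w = 0) ∨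
    (F w = ∞ ∧ meromorphicOrderAt (fun ζ => affine (F ζ)) w ≤ ((-2 : ℤ) : WithTop ℤ))

/-! ### Singularities of the inverse function -/

/-- `a` is the limit of `Ψ` along a path tending to `∞`. -/
def IsAsymptoticValue (Ψ : ℂ → Sphere) (a : Sphere) : Prop :=
  ∃ α : ℝ → ℂ, ContinuousOn α (Ioi 0) ∧ Tendsto α atTop (cocompact ℂ) ∧
    Tendsto (fun τ => Ψ (α τ)) atTop (𝓝 a)

/-- A transcendental singularity over `a` of the inverse of `Ψ`: a monotone choice of components
`U ρ` of the preimages of the disks `D(a, ρ)`, `ρ > 0`, with empty intersection. -/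
def IsTranscendentalSingularity (Ψ : ℂ → Sphere) (a : Sphere) (U : Ioi (0 : ℝ) → Set ℂ) : Prop :=
  (∀ ρ : Ioi (0 : ℝ), ∃ z ∈ Ψ ⁻¹' sphericalDisk a ρ, U ρ = connectedComponentIn (Ψ ⁻¹' sphericalDisk a ρ) z) ∧
    Monotone U ∧ (⋂ ρ, U ρ) = ∅

/-- `Ψ : U → V` is a universal covering. -/
def IsUniversalCovering (Ψ : ℂ → Sphere) (U : Set ℂ) (V : Set Sphere) : Prop :=
  SimplyConnectedSpace U ∧
    ∃ h : MapsTo Ψ U V, IsCoveringMap (h.restrict Ψ U V) ∧ SurjOn Ψ U V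

/-- The singularity `U` over `a` is logarithmic. -/
def IsLogarithmic (Ψ : ℂ → Sphere) (a : Sphere) (U : Ioi (0 : ℝ) → Set ℂ) : Prop :=
  ∃ ρ : Ioi (0 : ℝ), IsUniversalCovering Ψ (U ρ) (sphericalDisk a ρ \ {a})

/-- There is a biholomorphism of the plane domain `U` onto the plane domain `V` which maps the
vector field `f(z) ∂/∂z` to `g(z) ∂/∂z`. -/
def Biholomorphic (U : Set ℂ) (f : ℂ → ℂ) (V : Set ℂ) (g : ℂ → ℂ) : Prop :=
  ∃ φ : ℂ → ℂ, DifferentiableOn ℂ φ U ∧ BijOn φ U V ∧ ∀ z ∈ U, deriv φ z * f z = g (φ z)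

/-- `(W, f(z) ∂/∂z)` is biholomorphic to a right half plane with `exp(z) ∂/∂z`. -/
def IsHyperbolicTract (W : Set ℂ) (f : ℂ → ℂ) : Prop :=
  IsOpen W ∧ ∃ c : ℝ, Biholomorphic W f {ζ | c < ζ.re} Complex.exp

/-- `(W, f(z) ∂/∂z)` is biholomorphic to a left half plane with `exp(z) ∂/∂z`. -/
def IsEllipticTract (W : Set ℂ) (f : ℂ → ℂ) : Prop :=
  IsOpen W ∧ ∃ c : ℝ, Biholomorphic W f {ζ | ζ.re < c} Complex.exp

/-- The singularity `U` over the finite value `a` has hyperbolic tracts. The vector field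
`exp(z) ∂/∂z` belongs to `a - exp(-z)`. For small `ρ` the tract `U ρ` with the vector field
`f(z) ∂/∂z` is biholomorphic to the preimage of `D(a, ρ)` under `a - exp(-z)` with the vector
field `exp(z) ∂/∂z`. This preimage is not exactly a half plane, since a spherical disk is in
general not a concentric Euclidean one; the neighborhoods of the singularity which correspond
exactly to half planes are cofinal among the `U ρ`. -/
def HasHyperbolicTracts (a : ℂ) (U : Ioi (0 : ℝ) → Set ℂ) (f : ℂ → ℂ) : Prop :=
  (∃ ρ₀ : Ioi (0 : ℝ), ∀ ρ ≤ ρ₀, Biholomorphic (U ρ) f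
    {ζ | ((a - Complex.exp (-ζ) : ℂ) : Sphere) ∈ sphericalDisk (a : Sphere) ρ} Complex.exp) ∧
  ∀ ρ : Ioi (0 : ℝ), ∃ ρ' : Ioi (0 : ℝ), ∃ W : Set ℂ, U ρ' ⊆ W ∧ W ⊆ U ρ ∧ IsHyperbolicTract W f

/-- The singularity `U` (over `∞`) has elliptic tracts. -/
def HasEllipticTracts (U : Ioi (0 : ℝ) → Set ℂ) (f : ℂ → ℂ) : Prop :=
  ∃ ρ₀ : Ioi (0 : ℝ), ∀ ρ ≤ ρ₀, IsEllipticTract (U ρ) f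

/-! ### The four subfamilies -/

/-- The four configurations of the points `a₀`, `a_∞` and `∞`. -/
def Configuration (a₀ a₁ : Sphere) : Fin 4 → Prop :=
  ![a₀ ≠ a₁ ∧ a₀ ≠ ∞ ∧ a₁ ≠ ∞,
    a₀ = a₁ ∧ a₁ ≠ ∞,
    (a₀ ≠ ∞ ∧ a₁ = ∞) ∨ (a₀ = ∞ ∧ a₁ ≠ ∞),
    a₀ = ∞ ∧ a₁ = ∞]

/-- The subfamilies of the rational functions of degree `r`. -/
def subfamily (r : ℕ) (j : Fin 4) : Set (RatMaps r) :=
  {R | Configuration (ratMap R.1 ((0 : ℂ) : Sphere)) (ratMap R.1 ∞) j}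

end PeriodicFields

end

noncomputable section

namespace PeriodicFields

/-! ### The spherical metric -/

/-! Put l = 2πi/T. Then Ψ is the rational map N/D composed with exp(lz), and reversing the
coefficients (`Polynomial.reflect`) writes it also as N'/D' composed with exp(-lz). `CylinderMap`
records both forms, so the end w = ∞ is treated as the end w = 0 of the reversed pair.

Near w = 0 the rational map is a - w^k g(w), or -1/(w^k g(w)) if a = ∞, with g(0) ≠ 0. If G is a
logarithm of g, the coordinate φ = ku + G(exp u), u = lz, turns Ψ into a - exp φ or -exp(-φ)
exactly. Far to the left φ is a small Lipschitz perturbation of ku, hence injective, and its image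
contains a half plane (`exists_log_coordinate`, `exists_logEnd`). The preimage of a small disk under
this model is contractible and covers the punctured disk; this gives the logarithmic singularities,
and the chain rule gives the normal form of X.

There are no other singularities or asymptotic values because of `exists_bounded_or_half_plane`. Two
circles about 0 and a radial segment between them can be chosen to miss the finite fibre over a.
Their pullback under exp(lz) cuts the plane into two half planes and bounded rectangles, and Ψ stays
away from a on it. Hence an unbounded connected set mapped close to a lies in one of the half
planes. Tails of asymptotic paths are unbounded, and so are the sets U(ρ)
(`IsTranscendentalSingularity.not_isBounded`).

The poles and zeros of X are read off from Ψ' on the fibres of the exponential; residues vanish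
because dz/f = dΨ. If X were meromorphic at ∞, periodicity would make f constant and Ψ a nonconstant
affine function, which is not periodic.

In homogeneous coefficients subfamily (i) is given by polynomial inequations, hence open. Density
follows from two deformations: R(w + t) separates the values at 0 and ∞, and R/(1 + sR) then makes
both finite. -/

lemma sphericalDist_coe_coe (z w : ℂ) : sphericalDist (z : Sphere) (w : Sphere) =
    2 * Real.arcsin (‖z - w‖ / (√(1 + ‖z‖ ^ 2) * √(1 + ‖w‖ ^ 2))) := rfl

lemma sphericalDist_coe_infty (z : ℂ) : sphericalDist (z : Sphere) ∞ =
    2 * Real.arcsin (1 / √(1 + ‖z‖ ^ 2)) := rfl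

lemma sphericalDist_infty_coe (z : ℂ) : sphericalDist ∞ (z : Sphere) =
    2 * Real.arcsin (1 / √(1 + ‖z‖ ^ 2)) := rfl

lemma sphericalDist_infty_infty : sphericalDist ∞ ∞ = 0 := rfl

lemma sphericalDist_self (a : Sphere) : sphericalDist a a = 0 := by
  induction a using OnePoint.rec with
  | infty => rfl
  | coe z => simp [sphericalDist_coe_coe]

lemma sphericalDist_pos {a b : Sphere} (h : a ≠ b) : 0 < sphericalDist a b := by
  induction a using OnePoint.rec with
  | infty =>
    induction b using OnePoint.rec with
    | infty => exact absurd rfl h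
    | coe w =>
      rw [sphericalDist_infty_coe]
      have : 0 < 1 / √(1 + ‖w‖ ^ 2) := by positivity
      have := Real.arcsin_pos.2 this
      positivity
  | coe z =>
    induction b using OnePoint.rec with
    | infty =>
      rw [sphericalDist_coe_infty]
      have : 0 < 1 / √(1 + ‖z‖ ^ 2) := by positivity
      have := Real.arcsin_pos.2 this
      positivity
    | coe w =>
      have hzw : 0 < ‖z - w‖ := norm_pos_iff.2 (sub_ne_zero.2 fun h' => h (by rw [h']))
      rw [sphericalDist_coe_coe]
      have : 0 < ‖z - w‖ / (√(1 + ‖z‖ ^ 2) * √(1 + ‖w‖ ^ 2)) := by positivity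
      have := Real.arcsin_pos.2 this
      positivity

lemma tendsto_inv_coclosedCompact :
    Tendsto (fun w : ℂ => w⁻¹) (coclosedCompact ℂ) (𝓝 0) := by
  rw [Filter.coclosedCompact_eq_cocompact, ← Metric.cobounded_eq_cocompact]
  exact Filter.tendsto_inv₀_cobounded

lemma eventually_ne_zero_coclosedCompact : ∀ᶠ w : ℂ in coclosedCompact ℂ, w ≠ 0 := by
  rw [Filter.coclosedCompact_eq_cocompact]
  exact (isCompact_singleton (x := (0 : ℂ))).compl_mem_cocompact

lemma sqrt_one_add_norm_sq {w : ℂ} (hw : w ≠ 0) :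
    √(1 + ‖w‖ ^ 2) = ‖w‖ * √(1 + ‖w⁻¹‖ ^ 2) := by
  have h : 0 < ‖w‖ := norm_pos_iff.2 hw
  rw [← Real.sqrt_sq h.le, ← Real.sqrt_mul (by positivity), Real.sqrt_sq h.le, norm_inv]
  congr 1
  field_simp
  ring

/-- At ∞ the substitution s = 1/w makes the formula continuous at s = 0. Together with positivity
off the diagonal and compactness of the sphere this links the disks to the topology of `OnePoint`;
the triangle inequality is never needed. -/
lemma continuous_sphericalDist (a : Sphere) : Continuous (sphericalDist a) := by
  rw [OnePoint.continuous_iff]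
  have hpos : ∀ w : ℂ, √(1 + ‖w‖ ^ 2) ≠ 0 := fun w => by positivity
  induction a using OnePoint.rec with
  | infty =>
    simp only [sphericalDist_infty_coe, sphericalDist_infty_infty]
    constructor
    · have h0 : Tendsto (fun s : ℂ => 2 * Real.arcsin (‖s‖ / √(1 + ‖s‖ ^ 2))) (𝓝 0) (𝓝 0) := by
        have : Continuous fun s : ℂ => 2 * Real.arcsin (‖s‖ / √(1 + ‖s‖ ^ 2)) :=
          continuous_const.mul (Real.continuous_arcsin.comp
            (continuous_norm.div (by fun_prop) hpos))
        simpa using this.tendsto 0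
      refine (h0.comp tendsto_inv_coclosedCompact).congr' ?_
      filter_upwards [eventually_ne_zero_coclosedCompact] with w hw
      have h : 0 < ‖w‖ := norm_pos_iff.2 hw
      rw [Function.comp_apply, sqrt_one_add_norm_sq hw, norm_inv]
      congr 2
      field_simp
    · exact continuous_const.mul (Real.continuous_arcsin.comp
        (continuous_const.div (by fun_prop) hpos))
  | coe z =>
    simp only [sphericalDist_coe_coe, sphericalDist_coe_infty]
    constructor
    · have h0 : Tendsto (fun s : ℂ => 2 * Real.arcsin
          (‖z * s - 1‖ / (√(1 + ‖z‖ ^ 2) * √(1 + ‖s‖ ^ 2)))) (𝓝 0)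
          (𝓝 (2 * Real.arcsin (1 / √(1 + ‖z‖ ^ 2)))) := by
        have : Continuous fun s : ℂ => 2 * Real.arcsin
          (‖z * s - 1‖ / (√(1 + ‖z‖ ^ 2) * √(1 + ‖s‖ ^ 2))) :=
          continuous_const.mul (Real.continuous_arcsin.comp
            (Continuous.div (by fun_prop) (by fun_prop) fun w => mul_ne_zero (hpos _) (hpos w)))
        simpa using this.tendsto 0
      refine (h0.comp tendsto_inv_coclosedCompact).congr' ?_
      filter_upwards [eventually_ne_zero_coclosedCompact] with w hw
      have h : 0 < ‖w‖ := norm_pos_iff.2 hw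
      have h1 : ‖z * w⁻¹ - 1‖ = ‖z - w‖ / ‖w‖ := by
        rw [← norm_div]; congr 1; field_simp
      rw [Function.comp_apply, sqrt_one_add_norm_sq hw, h1]
      congr 2
      field_simp
    · exact continuous_const.mul (Real.continuous_arcsin.comp
        (Continuous.div (by fun_prop) (by fun_prop) fun w => mul_ne_zero (hpos _) (hpos w)))

lemma isOpen_sphericalDisk (a : Sphere) (ρ : ℝ) : IsOpen (sphericalDisk a ρ) :=
  isOpen_lt (continuous_sphericalDist a) continuous_const

lemma mem_sphericalDisk_self (a : Sphere) {ρ : ℝ} (h : 0 < ρ) : a ∈ sphericalDisk a ρ := by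
  rwa [sphericalDisk, mem_ofPred_eq, sphericalDist_self]

lemma sphericalDisk_mono (a : Sphere) {ρ ρ' : ℝ} (h : ρ ≤ ρ') :
    sphericalDisk a ρ ⊆ sphericalDisk a ρ' := fun _ hb => lt_of_lt_of_le hb h

/-- The distance from a attains a positive minimum on the compact complement of an open neighborhood
of a. -/
lemma exists_sphericalDisk_subset {a : Sphere} {V : Set Sphere} (hV : V ∈ 𝓝 a) :
    ∃ ρ > 0, sphericalDisk a ρ ⊆ V := by
  obtain ⟨W, hWV, hW, haW⟩ := mem_nhds_iff.1 hV
  rcases Wᶜ.eq_empty_or_nonempty with h | h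
  · exact ⟨1, one_pos, fun b _ => hWV (by rw [compl_empty_iff.1 h]; trivial)⟩
  · obtain ⟨b, hb, hmin⟩ := hW.isClosed_compl.isCompact.exists_isMinOn h
      (continuous_sphericalDist a).continuousOn
    refine ⟨sphericalDist a b, sphericalDist_pos fun h' => hb (h' ▸ haW), fun c hc => ?_⟩
    by_contra hcV
    exact not_le.2 hc (isMinOn_iff.1 hmin c fun h => hcV (hWV h))

lemma sphericalDisk_mem_nhds (a : Sphere) {ρ : ℝ} (h : 0 < ρ) : sphericalDisk a ρ ∈ 𝓝 a :=
  (isOpen_sphericalDisk a ρ).mem_nhds (mem_sphericalDisk_self a h)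

lemma eq_of_forall_mem_sphericalDisk {a b : Sphere} (h : ∀ ρ > 0, b ∈ sphericalDisk a ρ) :
    b = a := by
  by_contra hne
  have hb : sphericalDist a b < sphericalDist a b := h _ (sphericalDist_pos (Ne.symm hne))
  exact lt_irrefl _ hb

/-- Since `Real.arcsin` is constant on each side of [-1, 1], x needs no bound. -/
lemma two_mul_arcsin_lt_iff {ρ : ℝ} (h0 : 0 < ρ) (hπ : ρ ≤ Real.pi) (x : ℝ) :
    2 * Real.arcsin x < ρ ↔ x < Real.sin (ρ / 2) := by
  rw [← Real.arcsin_lt_iff_lt_sin' ⟨by linarith [Real.pi_pos], by linarith⟩]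
  constructor <;> intro h <;> linarith

lemma coe_mem_sphericalDisk_coe {ρ : ℝ} (h0 : 0 < ρ) (hπ : ρ ≤ Real.pi) (z w : ℂ) :
    (w : Sphere) ∈ sphericalDisk (z : Sphere) ρ ↔
      ‖z - w‖ ^ 2 < Real.sin (ρ / 2) ^ 2 * ((1 + ‖z‖ ^ 2) * (1 + ‖w‖ ^ 2)) := by
  have hs : 0 < Real.sin (ρ / 2) := Real.sin_pos_of_pos_of_lt_pi (by linarith) (by linarith)
  rw [sphericalDisk, mem_ofPred_eq, sphericalDist_coe_coe, two_mul_arcsin_lt_iff h0 hπ,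
    div_lt_iff₀ (by positivity), ← sq_lt_sq₀ (by positivity) (by positivity), mul_pow, mul_pow,
    Real.sq_sqrt (by positivity), Real.sq_sqrt (by positivity)]

lemma coe_mem_sphericalDisk_infty {ρ : ℝ} (h0 : 0 < ρ) (hπ : ρ ≤ Real.pi) (w : ℂ) :
    (w : Sphere) ∈ sphericalDisk ∞ ρ ↔ 1 / Real.sin (ρ / 2) ^ 2 - 1 < ‖w‖ ^ 2 := by
  have hs : 0 < Real.sin (ρ / 2) := Real.sin_pos_of_pos_of_lt_pi (by linarith) (by linarith)
  rw [sphericalDisk, mem_ofPred_eq, sphericalDist_infty_coe, two_mul_arcsin_lt_iff h0 hπ,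
    div_lt_comm₀ (by positivity) hs, ← sq_lt_sq₀ (by positivity) (by positivity),
    Real.sq_sqrt (by positivity), div_pow, one_pow, sub_lt_iff_lt_add']

/-! ### Quotients of two polynomials as maps to the sphere -/

open Polynomial in
/-- The sphere-valued map defined by a pair of polynomials. -/
def pairMap (N D : ℂ[X]) (w : ℂ) : Sphere :=
  if D.eval w = 0 then ∞ else ((N.eval w / D.eval w : ℂ) : Sphere)

open Polynomial in
/-- The polynomials have no common zero, and their quotient is not constant. -/
structure NonconstantPair (N D : ℂ[X]) : Prop where
  denom_ne_zero : D ≠ 0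
  sub_ne_zero : ∀ b : ℂ, N - C b * D ≠ 0
  eval_ne_zero : ∀ w : ℂ, D.eval w = 0 → N.eval w ≠ 0

section PairMap

open Polynomial

variable {N D : ℂ[X]}

lemma ratMap_coe (R : RatFunc ℂ) (w : ℂ) : ratMap R (w : Sphere) = pairMap R.num R.denom w := rfl

lemma psi_apply (R : RatFunc ℂ) (T z : ℂ) :
    psi R T z = pairMap R.num R.denom (Complex.exp (2 * Real.pi * Complex.I * z / T)) := rfl

lemma pairMap_of_eval_eq_zero {w : ℂ} (h : D.eval w = 0) : pairMap N D w = ∞ := if_pos h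

lemma pairMap_of_eval_ne_zero {w : ℂ} (h : D.eval w ≠ 0) :
    pairMap N D w = ((N.eval w / D.eval w : ℂ) : Sphere) := if_neg h

lemma pairMap_eq_infty_iff {w : ℂ} : pairMap N D w = ∞ ↔ D.eval w = 0 := by
  refine ⟨fun h => ?_, pairMap_of_eval_eq_zero⟩
  by_contra h'
  rw [pairMap_of_eval_ne_zero h'] at h
  exact OnePoint.coe_ne_infty _ h

lemma affine_coe (z : ℂ) : affine (z : Sphere) = z := rfl

lemma affine_pairMap (w : ℂ) : affine (pairMap N D w) = N.eval w / D.eval w := by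
  by_cases h : D.eval w = 0
  · rw [pairMap_of_eval_eq_zero h, h, div_zero]; rfl
  · rw [pairMap_of_eval_ne_zero h, affine_coe]

lemma continuous_pairMap (h : NonconstantPair N D) : Continuous (pairMap N D) := by
  rw [continuous_iff_continuousAt]
  intro w
  by_cases hw : D.eval w = 0
  -- Neighborhoods are split along {D ≠ 0}: there the value is N/D, which tends to ∞ since D/N → 0,
  -- and on the complement it is ∞ by definition.
  · have h1 : Tendsto (fun v => N.eval v / D.eval v) (𝓝[{v | D.eval v ≠ 0}] w)
        (Bornology.cobounded ℂ) := by
      have h2 : Tendsto (fun v => D.eval v / N.eval v) (𝓝[{v | D.eval v ≠ 0}] w) (𝓝[≠] 0) := by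
        refine tendsto_nhdsWithin_iff.2 ⟨?_, ?_⟩
        · have : ContinuousAt (fun v => D.eval v / N.eval v) w :=
            D.continuous.continuousAt.div N.continuous.continuousAt (h.eval_ne_zero w hw)
          have h3 := this.tendsto
          simp only [hw, zero_div] at h3
          exact h3.mono_left nhdsWithin_le_nhds
        · have hN : ∀ᶠ v in 𝓝[{v | D.eval v ≠ 0}] w, N.eval v ≠ 0 :=
            (N.continuous.continuousAt.eventually_ne (h.eval_ne_zero w hw)).filter_mono
              nhdsWithin_le_nhds
          filter_upwards [hN, self_mem_nhdsWithin] with v hv hv'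
          exact div_ne_zero hv' hv
      refine (tendsto_inv₀_nhdsNE_zero.comp h2).congr fun v => ?_
      simp
    rw [ContinuousAt, pairMap_of_eval_eq_zero hw]
    have h4 : Tendsto (pairMap N D) (𝓝[{v | D.eval v ≠ 0}] w) (𝓝 ∞) := by
      rw [Metric.cobounded_eq_cocompact, ← Filter.coclosedCompact_eq_cocompact] at h1
      refine (OnePoint.tendsto_coe_infty.comp h1).congr' ?_
      filter_upwards [self_mem_nhdsWithin] with v hv
      exact (pairMap_of_eval_ne_zero hv).symm
    have h5 : Tendsto (pairMap N D) (𝓝[{v | D.eval v ≠ 0}ᶜ] w) (𝓝 ∞) := by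
      refine tendsto_const_nhds.congr' ?_
      filter_upwards [self_mem_nhdsWithin] with v hv
      exact (pairMap_of_eval_eq_zero (not_not.1 hv)).symm
    have := h4.sup h5
    rwa [← nhdsWithin_union, union_compl_self, nhdsWithin_univ] at this
  · have h1 : ContinuousAt (fun v => ((N.eval v / D.eval v : ℂ) : Sphere)) w :=
      OnePoint.continuous_coe.continuousAt.comp
        (N.continuous.continuousAt.div D.continuous.continuousAt hw)
    refine h1.congr ?_
    filter_upwards [D.continuous.continuousAt.eventually_ne hw] with v hv
    exact (pairMap_of_eval_ne_zero hv).symm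

lemma finite_pairMap_eq (h : NonconstantPair N D) (a : Sphere) :
    {w | pairMap N D w = a}.Finite := by
  induction a using OnePoint.rec with
  | infty =>
    refine (D.rootSet_finite ℂ).subset fun w hw => ?_
    rw [mem_rootSet]
    exact ⟨h.denom_ne_zero, by simpa using pairMap_eq_infty_iff.1 hw⟩
  | coe b =>
    refine ((N - C b * D).rootSet_finite ℂ).subset fun w hw => ?_
    rw [mem_rootSet]
    refine ⟨h.sub_ne_zero b, ?_⟩
    have hw' : pairMap N D w = b := hw
    have hD : D.eval w ≠ 0 := fun h0 => by
      rw [pairMap_of_eval_eq_zero h0] at hw'; exact OnePoint.infty_ne_coe _ hw'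
    rw [pairMap_of_eval_ne_zero hD, OnePoint.coe_eq_coe, div_eq_iff hD] at hw'
    simp [hw']

lemma nonconstantPair_of_isCoprime (h : IsCoprime N D)
    (hr : 1 ≤ max N.natDegree D.natDegree) : NonconstantPair N D := by
  refine ⟨fun h0 => ?_, fun b hb => ?_, fun w hD hN => ?_⟩
  · rw [h0, isCoprime_zero_right] at h
    rw [h0, natDegree_eq_zero_of_isUnit h] at hr
    simp at hr
  · rw [_root_.sub_eq_zero] at hb
    have hu : IsUnit D := h.isUnit_of_dvd' (hb ▸ dvd_mul_left _ _) dvd_rfl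
    have hD := natDegree_eq_zero_of_isUnit hu
    have hN : N.natDegree ≤ D.natDegree := hb ▸ natDegree_C_mul_le b D
    omega
  · obtain ⟨p, q, hpq⟩ := h
    have := congrArg (eval w) hpq
    simp [hD, hN] at this

lemma nonconstantPair_num_denom {r : ℕ} (hr : 1 ≤ r) {R : RatFunc ℂ} (hR : ratDegree R = r) :
    NonconstantPair R.num R.denom :=
  nonconstantPair_of_isCoprime (RatFunc.isCoprime_num_denom R) (by rw [← hR] at hr; exact hr)

/-! ### Reversed polynomials and the value at infinity -/

lemma eval_reflect_inv_mul_pow {r : ℕ} {p : ℂ[X]} (hp : p.natDegree ≤ r) {w : ℂ} (hw : w ≠ 0) :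
    (p.reflect r).eval w⁻¹ * w ^ r = p.eval w := by
  let := invertibleOfNonzero hw
  have := eval₂_reflect_mul_pow (RingHom.id ℂ) w r p hp
  simpa [invOf_eq_inv, eval₂_id] using this

lemma pairMap_reflect_inv {r : ℕ} (hN : N.natDegree ≤ r) (hD : D.natDegree ≤ r) {w : ℂ}
    (hw : w ≠ 0) : pairMap (N.reflect r) (D.reflect r) w⁻¹ = pairMap N D w := by
  have hr : w ^ r ≠ 0 := pow_ne_zero _ hw
  rw [pairMap, pairMap, ← eval_reflect_inv_mul_pow hN hw, ← eval_reflect_inv_mul_pow hD hw,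
    mul_div_mul_right _ _ hr]
  simp [hr]

lemma eval_zero_reflect (r : ℕ) (p : ℂ[X]) : (p.reflect r).eval 0 = p.coeff r := by
  rw [← coeff_zero_eq_eval_zero, coeff_reflect, revAt_le (Nat.zero_le r), Nat.sub_zero]

/-- Away from 0 the zeros of the reversed polynomials are reciprocals of the original ones. At 0
their values are the coefficients of degree r, and these do not both vanish because r is the larger
degree. -/
lemma NonconstantPair.reflect {r : ℕ} (h : NonconstantPair N D)
    (hr : max N.natDegree D.natDegree = r) :
    NonconstantPair (N.reflect r) (D.reflect r) := by
  have hN : N.natDegree ≤ r := hr ▸ le_max_left _ _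
  have hD : D.natDegree ≤ r := hr ▸ le_max_right _ _
  refine ⟨?_, fun b => ?_, fun w hDw hNw => ?_⟩
  · rw [Ne, reflect_eq_zero_iff]; exact h.denom_ne_zero
  · rw [← reflect_C_mul, ← reflect_sub, Ne, reflect_eq_zero_iff]; exact h.sub_ne_zero b
  · rcases eq_or_ne w 0 with rfl | hw
    · rw [eval_zero_reflect] at hDw hNw
      rcases max_choice N.natDegree D.natDegree with hm | hm <;> rw [hr] at hm
      · rw [hm, coeff_natDegree, leadingCoeff_eq_zero] at hNw
        exact h.sub_ne_zero 0 (by simp [hNw])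
      · rw [hm, coeff_natDegree, leadingCoeff_eq_zero] at hDw
        exact h.denom_ne_zero hDw
    · have h1 := eval_reflect_inv_mul_pow hN (inv_ne_zero hw)
      have h2 := eval_reflect_inv_mul_pow hD (inv_ne_zero hw)
      rw [inv_inv, hNw, zero_mul] at h1
      rw [inv_inv, hDw, zero_mul] at h2
      exact h.eval_ne_zero _ h2.symm h1.symm

lemma ratMap_infty {r : ℕ} {R : RatFunc ℂ} (hR : ratDegree R = r) :
    ratMap R ∞ = pairMap (R.num.reflect r) (R.denom.reflect r) 0 := by
  have hN : R.num.natDegree ≤ r := hR ▸ le_max_left _ _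
  have hD : R.denom.natDegree ≤ r := hR ▸ le_max_right _ _
  rw [pairMap, eval_zero_reflect, eval_zero_reflect]
  change (if R.denom.natDegree < R.num.natDegree then ∞
      else ((R.num.coeff R.denom.natDegree / R.denom.leadingCoeff : ℂ) : Sphere)) = _
  by_cases h : R.denom.natDegree < R.num.natDegree
  · have hr : r = R.num.natDegree := by rw [← hR, ratDegree, max_eq_left h.le]
    rw [if_pos h, if_pos (coeff_eq_zero_of_natDegree_lt (hr ▸ h))]
  · have hr : r = R.denom.natDegree := by rw [← hR, ratDegree, max_eq_right (not_lt.1 h)]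
    have hc : R.denom.coeff r ≠ 0 := by
      rw [hr, coeff_natDegree]
      exact leadingCoeff_ne_zero.2 (RatFunc.denom_ne_zero R)
    rw [if_neg h, if_neg hc, hr, coeff_natDegree]

end PairMap

/-! ### Logarithmic coordinates at the ends of a cylinder -/

lemma exists_analyticAt_log {h : ℂ → ℂ} (hh : AnalyticAt ℂ h 0) (h0 : h 0 ≠ 0) :
    ∃ G : ℂ → ℂ, AnalyticAt ℂ G 0 ∧ ∀ᶠ w in 𝓝 0, Complex.exp (G w) = h w := by
  -- Dividing by h 0 brings the value at 0 to 1, inside the domain of analyticity of the principal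
  -- logarithm.
  refine ⟨fun w => Complex.log (h w / h 0) + Complex.log (h 0), ?_, ?_⟩
  · refine (AnalyticAt.clog (hh.div analyticAt_const h0) ?_).add analyticAt_const
    simp [div_self h0]
  · filter_upwards [hh.continuousAt.eventually_ne h0] with w hw
    rw [Complex.exp_add, Complex.exp_log (div_ne_zero hw h0), Complex.exp_log h0,
      div_mul_cancel₀ _ h0]

lemma exists_fixedPoint_of_lipschitz {s : Set ℂ} (hs : IsClosed s) (hne : s.Nonempty) {F : ℂ → ℂ}
    (hmaps : MapsTo F s s) (hF : ∀ u ∈ s, ∀ v ∈ s, ‖F u - F v‖ ≤ 1 / 2 * ‖u - v‖) :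
    ∃ u ∈ s, F u = u := by
  obtain ⟨x, hx⟩ := hne
  have hc : ContractingWith (1 / 2 : NNReal) (hmaps.restrict F s s) := by
    refine ⟨by rw [div_lt_one (by norm_num)]; norm_num, LipschitzWith.of_dist_le_mul ?_⟩
    intro u v
    rw [Subtype.dist_eq, Subtype.dist_eq, dist_eq_norm, dist_eq_norm]
    simpa using hF u u.2 v v.2
  obtain ⟨u, hu, hfix, -⟩ := hc.exists_fixedPoint' hs.isComplete hmaps hx (edist_ne_top _ _)
  exact ⟨u, hu, hfix⟩

/-- On a left half plane, `k u + G(exp u)` is a logarithm of `(exp u) ^ k * h(exp u)` and a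
bi-Lipschitz coordinate, whose image contains a left half plane. -/
lemma exists_log_coordinate {h : ℂ → ℂ} (hh : AnalyticAt ℂ h 0) (h0 : h 0 ≠ 0) {k : ℕ}
    (hk : 1 ≤ k) (M₀ : ℝ) :
    ∃ (φ : ℂ → ℂ) (M M' : ℝ), M₀ ≤ M ∧
      (∀ u : ℂ, u.re < -M → DifferentiableAt ℂ φ u) ∧
      (∀ u : ℂ, u.re < -M → deriv φ u ≠ 0) ∧
      (∀ u : ℂ, u.re < -M → Complex.exp (φ u) = Complex.exp u ^ k * h (Complex.exp u)) ∧
      (∀ u v : ℂ, u.re < -M → v.re < -M → ‖u - v‖ ≤ 2 * ‖φ u - φ v‖) ∧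
      (∀ ζ : ℂ, ζ.re < -M' → ∃ u : ℂ, u.re < -M ∧ φ u = ζ) ∧
      (∀ u : ℂ, u.re < -M → (φ u).re < -M' → u.re < -M - 1) := by
  obtain ⟨G, hG, hexp⟩ := exists_analyticAt_log hh h0
  have hk' : (1 : ℝ) ≤ k := by exact_mod_cast hk
  set B : ℝ := ‖deriv G 0‖ + 1
  set B' : ℝ := ‖G 0‖ + 1
  have hev : ∀ᶠ w in 𝓝 (0 : ℂ), Complex.exp (G w) = h w ∧ DifferentiableAt ℂ G w ∧
      ‖deriv G w‖ ≤ B ∧ ‖G w‖ ≤ B' := by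
    have h1 : ∀ᶠ w in 𝓝 (0 : ℂ), ‖deriv G w‖ < B :=
      hG.deriv.continuousAt.norm.eventually_lt continuousAt_const (lt_add_one _)
    have h2 : ∀ᶠ w in 𝓝 (0 : ℂ), ‖G w‖ < B' :=
      hG.continuousAt.norm.eventually_lt continuousAt_const (lt_add_one _)
    filter_upwards [hexp, hG.eventually_analyticAt, h1, h2] with w a b c d
    exact ⟨a, b.differentiableAt, c.le, d.le⟩
  obtain ⟨δ, hδ, hball⟩ := Metric.eventually_nhds_iff_ball.1 hev
  have hlim : Tendsto (fun M : ℝ => Real.exp (-M)) atTop (𝓝 0) :=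
    Real.tendsto_exp_atBot.comp tendsto_neg_atTop_atBot
  have hlim2 : Tendsto (fun M : ℝ => B * Real.exp (-M)) atTop (𝓝 0) := by
    simpa using hlim.const_mul B
  -- The bound B exp(-M) < 1/2 makes G ∘ exp Lipschitz with constant 1/2 on Re u < -M, a small
  -- perturbation of ku because k ≥ 1.
  obtain ⟨M, hM0, hMδ, hMB⟩ := ((eventually_ge_atTop M₀).and
    ((hlim.eventually_lt_const hδ).and
      (hlim2.eventually_lt_const (show (0 : ℝ) < 1 / 2 by norm_num)))).exists
  have hmem : ∀ u : ℂ, u.re < -M → Complex.exp u ∈ Metric.ball (0 : ℂ) δ := fun u hu => by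
    rw [mem_ball_zero_iff, Complex.norm_exp]
    exact (Real.exp_lt_exp.2 hu).trans hMδ
  have hd : ∀ u : ℂ, u.re < -M → HasDerivAt (fun u => G (Complex.exp u))
      (deriv G (Complex.exp u) * Complex.exp u) u := fun u hu =>
    (hball _ (hmem u hu)).2.1.hasDerivAt.comp u (Complex.hasDerivAt_exp u)
  have hdn : ∀ u : ℂ, u.re < -M → ‖deriv G (Complex.exp u) * Complex.exp u‖ ≤ 1 / 2 := by
    intro u hu
    rw [norm_mul, Complex.norm_exp]
    calc _ ≤ B * Real.exp (-M) := by
          gcongr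
          exact (hball _ (hmem u hu)).2.2.1
      _ ≤ 1 / 2 := hMB.le
  have hlip : ∀ u v : ℂ, u.re < -M → v.re < -M →
      ‖G (Complex.exp u) - G (Complex.exp v)‖ ≤ 1 / 2 * ‖u - v‖ := fun u v hu hv =>
    Convex.norm_image_sub_le_of_norm_hasDerivWithin_le (s := {u : ℂ | u.re < -M})
      (f := fun u => G (Complex.exp u))
      (fun x hx => (hd x hx).hasDerivWithinAt) (fun x hx => hdn x hx)
      (convex_halfSpace_re_lt (-M)) hv hu
  have hdφ : ∀ u : ℂ, u.re < -M → HasDerivAt (fun u => k * u + G (Complex.exp u))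
      (k + deriv G (Complex.exp u) * Complex.exp u) u := fun u hu => by
    have h1 : HasDerivAt (fun u : ℂ => (k : ℂ) * u) k u := by
      simpa using (hasDerivAt_id u).const_mul (k : ℂ)
    exact h1.add (hd u hu)
  have hkn : ‖(k : ℂ)‖ = k := Complex.norm_natCast k
  have hkC : (k : ℂ) ≠ 0 := by exact_mod_cast (by omega : k ≠ 0)
  -- As |φ(u) - ku| ≤ B', this M' makes Re φ(u) < -M' imply Re u < -M - 1. The margin 1 later keeps
  -- closures inside the open half plane.
  refine ⟨fun u => k * u + G (Complex.exp u), M, B' + k * (M + 1), hM0,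
    fun u hu => (hdφ u hu).differentiableAt, fun u hu => ?_, fun u hu => ?_,
    fun u v hu hv => ?_, fun ζ hζ => ?_, fun u hu hφ => ?_⟩
  · rw [(hdφ u hu).deriv]
    intro h'
    have h1 : (k : ℂ) = -(deriv G (Complex.exp u) * Complex.exp u) := eq_neg_of_add_eq_zero_left h'
    have h2 := hdn u hu
    rw [← norm_neg, ← h1, hkn] at h2
    linarith
  · rw [Complex.exp_add, Complex.exp_nat_mul, (hball _ (hmem u hu)).1]
  · have h1 : (k : ℂ) * (u - v) = (k * u + G (Complex.exp u) - (k * v + G (Complex.exp v))) -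
      (G (Complex.exp u) - G (Complex.exp v)) := by ring
    have h2 := norm_sub_le (k * u + G (Complex.exp u) - (k * v + G (Complex.exp v)))
      (G (Complex.exp u) - G (Complex.exp v))
    rw [← h1, norm_mul, hkn] at h2
    have h3 := hlip u v hu hv
    nlinarith [norm_nonneg (u - v)]
  · have hG' : ∀ u : ℂ, u.re < -M → ‖G (Complex.exp u)‖ ≤ B' := fun u hu =>
      (hball _ (hmem u hu)).2.2.2
    -- The equation φ(u) = ζ is the fixed point equation of the contraction u ↦ (ζ - G(exp u))/k,
    -- which preserves the closed half plane Re u ≤ -M - 1.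
    obtain ⟨u, hu, hfix⟩ := exists_fixedPoint_of_lipschitz (s := {u : ℂ | u.re ≤ -M - 1})
      (isClosed_le Complex.continuous_re continuous_const) ⟨((-M - 1 : ℝ) : ℂ), by simp⟩
      (F := fun u => (ζ - G (Complex.exp u)) / k)
      (fun u hu => by
        have hu' : u.re < -M := by have : u.re ≤ -M - 1 := hu; linarith
        have h1 : ((ζ - G (Complex.exp u)) / k).re = (ζ.re - (G (Complex.exp u)).re) / k := by
          rw [Complex.div_natCast_re, Complex.sub_re]
        change ((ζ - G (Complex.exp u)) / k).re ≤ -M - 1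
        rw [h1, div_le_iff₀ (by linarith)]
        have h2 := (abs_le.1 ((Complex.abs_re_le_norm _).trans (hG' u hu'))).1
        linarith)
      (fun u hu v hv => by
        have hu' : u.re < -M := by have : u.re ≤ -M - 1 := hu; linarith
        have hv' : v.re < -M := by have : v.re ≤ -M - 1 := hv; linarith
        have h1 : (ζ - G (Complex.exp u)) / k - (ζ - G (Complex.exp v)) / k =
          -(G (Complex.exp u) - G (Complex.exp v)) / k := by ring
        rw [h1, norm_div, norm_neg, hkn, div_le_iff₀ (by linarith)]
        have h3 := hlip u v hu' hv'
        nlinarith [norm_nonneg (u - v)])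
    refine ⟨u, by have : u.re ≤ -M - 1 := hu; linarith, ?_⟩
    rw [div_eq_iff hkC] at hfix
    linear_combination -hfix
  · have h2 := (abs_le.1 ((Complex.abs_re_le_norm _).trans (hball _ (hmem u hu)).2.2.2)).1
    simp only [Complex.add_re, Complex.mul_re, Complex.natCast_re, Complex.natCast_im,
      zero_mul, sub_zero] at hφ
    nlinarith

/-! ### The model of a logarithmic singularity -/

/-- The model of a logarithmic singularity over `a`, on left half planes: the function
`a - exp ζ` if `a` is finite, and `-exp(-ζ)` if `a = ∞`. -/
def endModel : Sphere → ℂ → ℂ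
  | ∞ => fun ζ => -Complex.exp (-ζ)
  | (b : ℂ) => fun ζ => b - Complex.exp ζ

lemma endModel_infty (ζ : ℂ) : endModel ∞ ζ = -Complex.exp (-ζ) := rfl

lemma endModel_coe (b ζ : ℂ) : endModel (b : Sphere) ζ = b - Complex.exp ζ := rfl

lemma endModel_ne (a : Sphere) (ζ : ℂ) : (endModel a ζ : Sphere) ≠ a := by
  induction a using OnePoint.rec with
  | infty => exact OnePoint.coe_ne_infty _
  | coe b =>
    rw [endModel_coe, Ne, OnePoint.coe_eq_coe, sub_eq_self]
    exact Complex.exp_ne_zero ζ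

lemma exists_re_lt_of_endModel_mem (a : Sphere) (M : ℝ) :
    ∃ ρ > 0, ∀ ζ, (endModel a ζ : Sphere) ∈ sphericalDisk a ρ → ζ.re < -M := by
  induction a using OnePoint.rec with
  | infty =>
    have hV : (((↑) : ℂ → Sphere) '' Metric.closedBall 0 (Real.exp M))ᶜ ∈ 𝓝 (∞ : Sphere) :=
      (OnePoint.isOpen_compl_image_coe.2 ⟨Metric.isClosed_closedBall,
        isCompact_closedBall _ _⟩).mem_nhds (by simp)
    obtain ⟨ρ, hρ, hsub⟩ := exists_sphericalDisk_subset hV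
    refine ⟨ρ, hρ, fun ζ hζ => ?_⟩
    by_contra hlt
    refine hsub hζ ⟨_, ?_, rfl⟩
    rw [mem_closedBall_zero_iff, endModel_infty, norm_neg, Complex.norm_exp, Complex.neg_re,
      Real.exp_le_exp]
    linarith
  | coe b =>
    have hV : ((↑) : ℂ → Sphere) '' Metric.ball b (Real.exp (-M)) ∈ 𝓝 (b : Sphere) :=
      (OnePoint.isOpen_image_coe.2 Metric.isOpen_ball).mem_nhds
        ⟨b, Metric.mem_ball_self (Real.exp_pos _), rfl⟩
    obtain ⟨ρ, hρ, hsub⟩ := exists_sphericalDisk_subset hV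
    refine ⟨ρ, hρ, fun ζ hζ => ?_⟩
    obtain ⟨c, hc, hceq⟩ := hsub hζ
    rw [OnePoint.coe_eq_coe] at hceq
    rw [hceq, endModel_coe, mem_ball_iff_norm', sub_sub_cancel, Complex.norm_exp,
      Real.exp_lt_exp] at hc
    exact hc

lemma exists_endModel_mem (a : Sphere) {ρ : ℝ} (hρ : 0 < ρ) :
    ∃ L : ℝ, ∀ ζ : ℂ, ζ.re < -L → (endModel a ζ : Sphere) ∈ sphericalDisk a ρ := by
  have hD := sphericalDisk_mem_nhds a hρ
  induction a using OnePoint.rec with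
  | infty =>
    have h1 := OnePoint.tendsto_coe_infty (X := ℂ) hD
    rw [Filter.coclosedCompact_eq_cocompact, ← Metric.cobounded_eq_cocompact] at h1
    obtain ⟨K, -, hK⟩ := (hasBasis_cobounded_norm (E := ℂ)).mem_iff.1 h1
    refine ⟨Real.log (max K 1), fun ζ hζ => hK ?_⟩
    rw [mem_ofPred_eq, endModel_infty, norm_neg, Complex.norm_exp, Complex.neg_re]
    calc K ≤ max K 1 := le_max_left _ _
      _ = Real.exp (Real.log (max K 1)) := (Real.exp_log (by positivity)).symm
      _ ≤ _ := Real.exp_le_exp.2 (by linarith)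
  | coe b =>
    rw [OnePoint.nhds_coe_eq, mem_map, Metric.mem_nhds_iff] at hD
    obtain ⟨δ, hδ, hsub⟩ := hD
    refine ⟨-Real.log δ, fun ζ hζ => hsub (?_ : endModel b ζ ∈ _)⟩
    rw [endModel_coe, mem_ball_iff_norm', sub_sub_cancel, Complex.norm_exp,
      ← Real.lt_log_iff_exp_lt hδ]
    linarith

/-- The preimage of `D(a, ρ)` under the model is a star domain with respect to `-∞`, it is
contained in a given left half plane, and the model is a covering there. -/
structure GoodRadius (a : Sphere) (M ρ : ℝ) : Prop where
  pos : 0 < ρ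
  le_pi : ρ ≤ Real.pi
  re_lt : ∀ ζ, (endModel a ζ : Sphere) ∈ sphericalDisk a ρ → ζ.re < -M
  sub_mem : ∀ ζ, (endModel a ζ : Sphere) ∈ sphericalDisk a ρ → ∀ s : ℝ, 0 ≤ s →
    (endModel a (ζ - s) : Sphere) ∈ sphericalDisk a ρ
  subset_range : sphericalDisk a ρ \ {a} ⊆ range fun ζ => (endModel a ζ : Sphere)
  isCoveringMapOn : IsCoveringMapOn (endModel a) ((↑) ⁻¹' (sphericalDisk a ρ \ {a}))

/-- The inequality reads (1 - κ)|t|² + 2κ Re(b̄t) < κ(1 + |b|²). For κ ≤ 1 this is a convex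
condition on t which holds at t = 0, so it passes to σt. -/
lemma norm_sq_sub_exp_lt {b t : ℂ} {κ σ : ℝ} (hκ : 0 < κ) (hκ1 : κ ≤ 1) (hσ : 0 < σ) (hσ1 : σ ≤ 1)
    (h : ‖t‖ ^ 2 < κ * (1 + ‖b - t‖ ^ 2)) :
    ‖σ * t‖ ^ 2 < κ * (1 + ‖b - σ * t‖ ^ 2) := by
  simp only [Complex.sq_norm, Complex.normSq_apply, Complex.sub_re, Complex.sub_im, Complex.mul_re,
    Complex.mul_im, Complex.ofReal_re, Complex.ofReal_im, zero_mul, sub_zero, add_zero] at h ⊢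
  set x := t.re
  set y := t.im
  have h1 : 0 ≤ (1 - κ) * (x * x + y * y) := mul_nonneg (by linarith)
    (add_nonneg (mul_self_nonneg _) (mul_self_nonneg _))
  have h2 : 0 ≤ σ * (1 - σ) * ((1 - κ) * (x * x + y * y)) :=
    mul_nonneg (mul_nonneg hσ.le (by linarith)) h1
  have h3 : 0 ≤ (1 - σ) * (κ * (1 + (b.re * b.re + b.im * b.im))) :=
    mul_nonneg (by linarith) (mul_nonneg hκ.le (add_nonneg zero_le_one
      (add_nonneg (mul_self_nonneg _) (mul_self_nonneg _))))
  have h4 := mul_lt_mul_of_pos_left h hσ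
  nlinarith

/-- The model omits two values, a and one other: 0 if a = ∞, and ∞ if a is finite. A disk too small
to contain the second one is star-shaped about a in the relevant coordinate, and over its punctured
part the model is a covering, being exp conjugated by homeomorphisms. -/
lemma exists_goodRadius (a : Sphere) (M : ℝ) :
    ∃ ρ₀ > 0, ∀ ρ, 0 < ρ → ρ ≤ ρ₀ → GoodRadius a M ρ := by
  obtain ⟨ρ₁, hρ₁, hre⟩ := exists_re_lt_of_endModel_mem a M
  have hre' : ∀ ρ ≤ ρ₁, ∀ ζ, (endModel a ζ : Sphere) ∈ sphericalDisk a ρ → ζ.re < -M :=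
    fun ρ h ζ hζ => hre ζ (sphericalDisk_mono a h hζ)
  induction a using OnePoint.rec with
  | infty =>
    have hzero : ∀ ρ, 0 < ρ → ρ ≤ Real.pi → ((0 : ℂ) : Sphere) ∉ sphericalDisk ∞ ρ := by
      intro ρ h0 hπ h
      rw [coe_mem_sphericalDisk_infty h0 hπ, norm_zero, zero_pow two_ne_zero, sub_neg,
        div_lt_one] at h
      · nlinarith [Real.sin_le_one (ρ / 2), Real.neg_one_le_sin (ρ / 2)]
      · have hs : 0 < Real.sin (ρ / 2) :=
          Real.sin_pos_of_pos_of_lt_pi (by linarith) (by linarith)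
        positivity
    refine ⟨min ρ₁ Real.pi, lt_min hρ₁ Real.pi_pos, fun ρ h0 h => ?_⟩
    have hπ : ρ ≤ Real.pi := h.trans (min_le_right _ _)
    refine ⟨h0, hπ, hre' ρ (h.trans (min_le_left _ _)), fun ζ hζ s hs => ?_, fun c hc => ?_, ?_⟩
    · rw [coe_mem_sphericalDisk_infty h0 hπ] at hζ ⊢
      refine hζ.trans_le ?_
      rw [endModel_infty, endModel_infty, norm_neg, norm_neg, Complex.norm_exp, Complex.norm_exp]
      have : Real.exp (-ζ).re ≤ Real.exp (-(ζ - s)).re := Real.exp_le_exp.2 (by simpa using hs)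
      gcongr
    · induction c using OnePoint.rec with
      | infty => exact absurd rfl hc.2
      | coe c =>
        have hc0 : c ≠ 0 := fun h => hzero ρ h0 hπ (h ▸ hc.1)
        refine ⟨-Complex.log (-c), ?_⟩
        simp only [endModel_infty, neg_neg]
        rw [Complex.exp_log (neg_ne_zero.2 hc0), neg_neg]
    · have h1 := (Complex.isCoveringMapOn_exp.comp_homeomorph
        (Homeomorph.neg ℂ)).homeomorph_comp (Homeomorph.neg ℂ)
      refine IsCoveringMapOn.mono h1 fun c hc => ?_
      have hc0 : c ≠ 0 := fun h => hzero ρ h0 hπ (h ▸ hc.1)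
      simpa using hc0
  | coe b =>
    -- By sin x ≤ x this bound on ρ gives sin(ρ/2) ≤ 1/√(1 + |b|²), that is, κ = sin²(ρ/2)(1 + |b|²)
    -- ≤ 1, and ∞ is not in the disk.
    refine ⟨min ρ₁ (2 / √(1 + ‖b‖ ^ 2)), lt_min hρ₁ (by positivity), fun ρ h0 h => ?_⟩
    have h2 : ρ ≤ 2 / √(1 + ‖b‖ ^ 2) := h.trans (min_le_right _ _)
    have hπ : ρ ≤ Real.pi := by
      refine h2.trans (le_trans ?_ Real.two_le_pi)
      refine div_le_self (by norm_num) (Real.one_le_sqrt.2 ?_)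
      nlinarith [norm_nonneg b]
    have hs : 0 < Real.sin (ρ / 2) := Real.sin_pos_of_pos_of_lt_pi (by linarith) (by linarith)
    have hκ1 : Real.sin (ρ / 2) ^ 2 * (1 + ‖b‖ ^ 2) ≤ 1 := by
      have h3 : Real.sin (ρ / 2) ≤ 1 / √(1 + ‖b‖ ^ 2) := by
        refine (Real.sin_le (by linarith)).trans ?_
        have : 2 / √(1 + ‖b‖ ^ 2) = 2 * (1 / √(1 + ‖b‖ ^ 2)) := by ring
        linarith
      have h4 : Real.sin (ρ / 2) ^ 2 ≤ (1 / √(1 + ‖b‖ ^ 2)) ^ 2 := by gcongr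
      rw [div_pow, Real.sq_sqrt (by positivity), one_pow] at h4
      rwa [← le_div_iff₀ (by positivity)]
    refine ⟨h0, hπ, hre' ρ (h.trans (min_le_left _ _)), fun ζ hζ s hs' => ?_, fun c hc => ?_, ?_⟩
    · rw [coe_mem_sphericalDisk_coe h0 hπ, endModel_coe, sub_sub_cancel, ← mul_assoc] at hζ ⊢
      have hexp : Complex.exp (ζ - s) = (Real.exp (-s) : ℝ) * Complex.exp ζ := by
        rw [Complex.ofReal_exp, ← Complex.exp_add]
        congr 1
        push_cast
        ring
      rw [hexp]
      exact norm_sq_sub_exp_lt (by positivity) hκ1 (Real.exp_pos _)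
        (Real.exp_le_one_iff.2 (by linarith)) hζ
    · induction c using OnePoint.rec with
      | infty =>
        have h1 : sphericalDist (b : Sphere) ∞ < ρ := hc.1
        rw [sphericalDist_coe_infty, two_mul_arcsin_lt_iff h0 hπ, div_lt_iff₀ (by positivity),
          ← sq_lt_sq₀ (by norm_num) (by positivity), mul_pow, Real.sq_sqrt (by positivity)] at h1
        linarith
      | coe c =>
        have hc0 : b - c ≠ 0 := fun h => hc.2 (by rw [sub_eq_zero.1 h]; rfl)
        refine ⟨Complex.log (b - c), ?_⟩
        simp only [endModel_coe]
        rw [Complex.exp_log hc0, sub_sub_cancel]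
    · have h1 := Complex.isCoveringMapOn_exp.homeomorph_comp (Homeomorph.subLeft b)
      refine IsCoveringMapOn.mono h1 fun c hc => ?_
      have hc0 : c ≠ b := fun h => hc.2 (by rw [h]; rfl)
      simpa [neg_add_eq_zero] using hc0

/-! ### Logarithmic ends -/

/-- A plane set which is a star domain with respect to `-∞`, bounded to the right, and contains a
left half plane is contractible. -/
lemma contractibleSpace_of_sub_mem {P : Set ℂ} {B L : ℝ} (hB : ∀ ζ ∈ P, ζ.re < B)
    (hL : ∀ ζ : ℂ, ζ.re < -L → ζ ∈ P) (hsub : ∀ ζ ∈ P, ∀ s : ℝ, 0 ≤ s → ζ - s ∈ P) :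
    ContractibleSpace P := by
  rw [contractible_iff_id_nullhomotopic]
  -- Translation by s carries all of P into the half plane Re ζ < -L; there a straight-line homotopy
  -- contracts it to a point.
  set s : ℝ := max (B + L) 0
  have hs : 0 ≤ s := le_max_right _ _
  have hsL : ∀ ζ ∈ P, (ζ - s).re < -L := fun ζ hζ => by
    have := hB ζ hζ
    have h2 : B + L ≤ s := le_max_left _ _
    rw [Complex.sub_re, Complex.ofReal_re]
    linarith
  have hp : ((-L - 1 : ℝ) : ℂ).re < -L := by simp
  refine ⟨⟨_, hL _ hp⟩, ?_⟩
  let shift : C(P, P) := ⟨fun ζ => ⟨ζ - s, hsub ζ ζ.2 s hs⟩, by fun_prop⟩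
  have h1 : (ContinuousMap.id P).Homotopic shift :=
    ⟨{ toFun := fun x => ⟨x.2 - ((x.1 * s : ℝ) : ℂ), hsub x.2 x.2.2 _ (mul_nonneg x.1.2.1 hs)⟩
       continuous_toFun := by fun_prop
       map_zero_left := fun x => by simp
       map_one_left := fun x => by simp [shift] }⟩
  have h2 : shift.Homotopic (ContinuousMap.const P ⟨((-L - 1 : ℝ) : ℂ), hL _ hp⟩) :=
    ⟨{ toFun := fun x => ⟨((1 - x.1 : ℝ) : ℂ) * (x.2 - s) + ((x.1 : ℝ) : ℂ) * ((-L - 1 : ℝ) : ℂ),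
        hL _ (by
          have ht := x.1.2
          have hx := hsL x.2 x.2.2
          rw [Complex.add_re, Complex.re_ofReal_mul, Complex.re_ofReal_mul]
          rcases ht.1.eq_or_lt with h0 | h0
          · rw [← h0]; simpa using hx
          · nlinarith [ht.2])⟩
       continuous_toFun := by fun_prop
       map_zero_left := fun x => by simp [shift]
       map_one_left := fun x => by simp }⟩
  exact h1.trans h2

/-- On the open set `H`, the function `Ψ` is the composition of the model of a logarithmic
singularity over `a` with the coordinate `φ`. -/
structure LogEnd (Ψ : ℂ → Sphere) (a : Sphere) (φ : ℂ → ℂ) (H : Set ℂ) (M : ℝ) : Prop where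
  continuous : Continuous Ψ
  isOpen : IsOpen H
  differentiableAt : ∀ z ∈ H, DifferentiableAt ℂ φ z
  deriv_ne_zero : ∀ z ∈ H, deriv φ z ≠ 0
  lipschitz_inv : ∃ K : NNReal, ∀ z ∈ H, ∀ w ∈ H, dist z w ≤ K * dist (φ z) (φ w)
  exists_eq : ∀ ζ : ℂ, ζ.re < -M → ∃ z ∈ H, φ z = ζ
  closure_subset : closure {z ∈ H | (φ z).re < -M} ⊆ H
  apply_eq : ∀ z ∈ H, Ψ z = (endModel a (φ z) : Sphere)

namespace LogEnd

variable {Ψ : ℂ → Sphere} {a : Sphere} {φ : ℂ → ℂ} {H : Set ℂ} {M ρ : ℝ}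

lemma injOn (E : LogEnd Ψ a φ H M) : InjOn φ H := by
  obtain ⟨K, hK⟩ := E.lipschitz_inv
  intro z hz w hw h
  have := hK z hz w hw
  rw [h, dist_self, mul_zero] at this
  exact dist_le_zero.1 this

lemma bijOn_half_plane (E : LogEnd Ψ a φ H M) {c : ℝ} (hc : c ≤ -M) :
    BijOn φ {z ∈ H | (φ z).re < c} {ζ | ζ.re < c} :=
  ⟨fun _ hz => hz.2, E.injOn.mono fun _ hz => hz.1, fun ζ hζ => by
    obtain ⟨z, hz, rfl⟩ := E.exists_eq ζ (lt_of_lt_of_le hζ hc)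
    exact ⟨z, ⟨hz, hζ⟩, rfl⟩⟩

lemma bijOn (E : LogEnd Ψ a φ H M) (hρ : GoodRadius a M ρ) :
    BijOn φ (H ∩ Ψ ⁻¹' sphericalDisk a ρ) {ζ | (endModel a ζ : Sphere) ∈ sphericalDisk a ρ} := by
  refine ⟨fun z hz => ?_, E.injOn.mono inter_subset_left, fun ζ hζ => ?_⟩
  · have := hz.2
    rwa [mem_preimage, E.apply_eq z hz.1] at this
  · obtain ⟨z, hz, rfl⟩ := E.exists_eq ζ (hρ.re_lt ζ hζ)
    exact ⟨z, ⟨hz, by rw [mem_preimage, E.apply_eq z hz]; exact hζ⟩, rfl⟩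

lemma isOpen_inter (E : LogEnd Ψ a φ H M) (ρ : ℝ) : IsOpen (H ∩ Ψ ⁻¹' sphericalDisk a ρ) :=
  E.isOpen.inter ((isOpen_sphericalDisk a ρ).preimage E.continuous)

/-- The model never takes the value a, so puncturing the disk does not change the preimage. -/
lemma preimage_endModel (a : Sphere) (ρ : ℝ) :
    endModel a ⁻¹' ((↑) ⁻¹' (sphericalDisk a ρ \ {a})) =
      {ζ | (endModel a ζ : Sphere) ∈ sphericalDisk a ρ} := by
  ext ζ
  exact ⟨fun h => h.1, fun h => ⟨h, endModel_ne a ζ⟩⟩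

/-- The coordinate as a homeomorphism. -/
def homeomorph (E : LogEnd Ψ a φ H M) (hρ : GoodRadius a M ρ) :
    (H ∩ Ψ ⁻¹' sphericalDisk a ρ : Set ℂ) ≃ₜ
      endModel a ⁻¹' ((↑) ⁻¹' (sphericalDisk a ρ \ {a})) :=
  have hb : BijOn φ (H ∩ Ψ ⁻¹' sphericalDisk a ρ)
      (endModel a ⁻¹' ((↑) ⁻¹' (sphericalDisk a ρ \ {a}))) :=
    (preimage_endModel a ρ).symm ▸ E.bijOn hρ
  { toEquiv := hb.equiv φ
    continuous_toFun := by
      refine Continuous.subtype_mk (continuousOn_iff_continuous_domRestrict.1 fun z hz => ?_) _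
      exact (E.differentiableAt z hz.1).continuousAt.continuousWithinAt
    continuous_invFun := by
      -- The inverse is continuous because it is Lipschitz.
      obtain ⟨K, hK⟩ := E.lipschitz_inv
      have h1 : AntilipschitzWith K (hb.equiv φ) := by
        refine AntilipschitzWith.of_le_mul_dist fun z w => ?_
        exact hK z z.2.1 w w.2.1
      exact (h1.to_rightInverse (hb.equiv φ).right_inv).continuous }

lemma homeomorph_apply (E : LogEnd Ψ a φ H M) (hρ : GoodRadius a M ρ)
    (z : (H ∩ Ψ ⁻¹' sphericalDisk a ρ : Set ℂ)) : (E.homeomorph hρ z : ℂ) = φ z := rfl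

lemma contractibleSpace (E : LogEnd Ψ a φ H M) (hρ : GoodRadius a M ρ) :
    ContractibleSpace (H ∩ Ψ ⁻¹' sphericalDisk a ρ : Set ℂ) := by
  have : ContractibleSpace (endModel a ⁻¹' ((↑) ⁻¹' (sphericalDisk a ρ \ {a}))) := by
    obtain ⟨L, hL⟩ := exists_endModel_mem a hρ.pos
    refine contractibleSpace_of_sub_mem (B := -M) (L := L) ?_ ?_ ?_ <;>
      rw [preimage_endModel]
    exacts [hρ.re_lt, hL, hρ.sub_mem]
  exact (E.homeomorph hρ).contractibleSpace

/-- Up to the homeomorphism φ and the embedding of ℂ in the sphere, Ψ is the restriction of the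
model to a full preimage, hence a covering; the total space is contractible. -/
lemma isUniversalCovering (E : LogEnd Ψ a φ H M) (hρ : GoodRadius a M ρ) :
    IsUniversalCovering Ψ (H ∩ Ψ ⁻¹' sphericalDisk a ρ) (sphericalDisk a ρ \ {a}) := by
  have := E.contractibleSpace hρ
  have hmaps : MapsTo Ψ (H ∩ Ψ ⁻¹' sphericalDisk a ρ) (sphericalDisk a ρ \ {a}) := fun z hz =>
    ⟨hz.2, by rw [E.apply_eq z hz.1]; exact endModel_ne a _⟩
  refine ⟨inferInstance, hmaps, ?_, fun c hc => ?_⟩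
  · have hr : sphericalDisk a ρ \ {a} ⊆ range ((↑) : ℂ → Sphere) := fun c hc => by
      obtain ⟨ζ, rfl⟩ := hρ.subset_range hc
      exact ⟨_, rfl⟩
    have h1 := (hρ.isCoveringMapOn.isCoveringMap_restrictPreimage.comp_homeomorph
      (E.homeomorph hρ)).homeomorph_comp
      (OnePoint.isOpenEmbedding_coe.isEmbedding.homeomorphOfSubsetRange hr)
    convert h1 using 1
    ext z
    change Ψ z = _
    rw [E.apply_eq z z.2.1]
    simp only [Function.comp_apply, IsEmbedding.homeomorphOfSubsetRange_apply_coe,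
      restrictPreimage_coe, homeomorph_apply]
  · obtain ⟨ζ, rfl⟩ := hρ.subset_range hc
    obtain ⟨z, hz, rfl⟩ := (E.bijOn hρ).surjOn hc.1
    exact ⟨z, hz, E.apply_eq z hz.1⟩

lemma isPreconnected (E : LogEnd Ψ a φ H M) (hρ : GoodRadius a M ρ) :
    IsPreconnected (H ∩ Ψ ⁻¹' sphericalDisk a ρ) := by
  have := E.contractibleSpace hρ
  exact isPreconnected_iff_preconnectedSpace.2 inferInstance

lemma nonempty (E : LogEnd Ψ a φ H M) (hρ : GoodRadius a M ρ) :
    (H ∩ Ψ ⁻¹' sphericalDisk a ρ).Nonempty := by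
  obtain ⟨L, hL⟩ := exists_endModel_mem a hρ.pos
  obtain ⟨z, hz, -⟩ := (E.bijOn hρ).surjOn (hL ((-L - 1 : ℝ) : ℂ) (by simp))
  exact ⟨z, hz⟩

lemma closure_inter_subset (E : LogEnd Ψ a φ H M) (hρ : GoodRadius a M ρ) :
    closure (H ∩ Ψ ⁻¹' sphericalDisk a ρ) ⊆ H := by
  refine Subset.trans (closure_mono ?_) E.closure_subset
  exact fun _ hz => ⟨hz.1, hρ.re_lt _ ((E.bijOn hρ).mapsTo hz)⟩

/-- The set on the right is connected and open, and its closure stays in H, so it is also relatively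
closed in the preimage of the disk. -/
lemma connectedComponentIn_eq (E : LogEnd Ψ a φ H M) (hρ : GoodRadius a M ρ) {z : ℂ}
    (hz : z ∈ H ∩ Ψ ⁻¹' sphericalDisk a ρ) :
    connectedComponentIn (Ψ ⁻¹' sphericalDisk a ρ) z = H ∩ Ψ ⁻¹' sphericalDisk a ρ := by
  refine Subset.antisymm (fun w hw => ?_)
    ((E.isPreconnected hρ).subset_connectedComponentIn hz inter_subset_right)
  refine isPreconnected_connectedComponentIn.subset_left_of_subset_union (E.isOpen_inter ρ)
    (isClosed_closure (s := H ∩ Ψ ⁻¹' sphericalDisk a ρ)).isOpen_compl ?_ ?_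
    ⟨z, mem_connectedComponentIn hz.2, hz⟩ hw
  · exact disjoint_compl_right.mono_left subset_closure
  · intro v hv
    by_cases h : v ∈ closure (H ∩ Ψ ⁻¹' sphericalDisk a ρ)
    · exact Or.inl ⟨E.closure_inter_subset hρ h, connectedComponentIn_subset _ _ hv⟩
    · exact Or.inr h

/-- The transcendental singularity defined by a logarithmic end. -/
lemma exists_isTranscendentalSingularity (E : LogEnd Ψ a φ H M) {ρ₀ : ℝ} (h₀ : 0 < ρ₀)
    (hgood : ∀ ρ, 0 < ρ → ρ ≤ ρ₀ → GoodRadius a M ρ) :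
    ∃ U, IsTranscendentalSingularity Ψ a U ∧
      ∀ ρ : Ioi (0 : ℝ), ρ.1 ≤ ρ₀ → U ρ = H ∩ Ψ ⁻¹' sphericalDisk a ρ := by
  have hg : ∀ ρ : Ioi (0 : ℝ), GoodRadius a M (min ρ.1 ρ₀) := fun ρ =>
    hgood _ (lt_min ρ.2 h₀) (min_le_right _ _)
  -- The end is understood only up to radius ρ₀. For larger radii the component is that of a point
  -- of the end at radius ρ₀.
  choose p hp using fun ρ : Ioi (0 : ℝ) => E.nonempty (hg ρ)
  have hp' : ∀ ρ : Ioi (0 : ℝ), p ρ ∈ Ψ ⁻¹' sphericalDisk a ρ := fun ρ =>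
    sphericalDisk_mono a (min_le_left _ _) (hp ρ).2
  have hU : ∀ ρ : Ioi (0 : ℝ), ρ.1 ≤ ρ₀ →
      connectedComponentIn (Ψ ⁻¹' sphericalDisk a ρ) (p ρ) = H ∩ Ψ ⁻¹' sphericalDisk a ρ := by
    intro ρ hρ
    refine E.connectedComponentIn_eq (hgood ρ ρ.2 hρ) ?_
    have := hp ρ
    rwa [min_eq_left hρ] at this
  refine ⟨fun ρ => connectedComponentIn (Ψ ⁻¹' sphericalDisk a ρ) (p ρ),
    ⟨fun ρ => ⟨p ρ, hp' ρ, rfl⟩, fun ρ₁ ρ₂ h => ?_, ?_⟩, hU⟩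
  · have h12 : ρ₁.1 ≤ ρ₂.1 := h
    have h1 : p ρ₁ ∈ connectedComponentIn (Ψ ⁻¹' sphericalDisk a ρ₂) (p ρ₂) :=
      (E.isPreconnected (hg ρ₂)).subset_connectedComponentIn (hp ρ₂)
        (inter_subset_right.trans (preimage_mono (sphericalDisk_mono a (min_le_left _ _))))
        ⟨(hp ρ₁).1, sphericalDisk_mono a (min_le_min_right _ h12) (hp ρ₁).2⟩
    change connectedComponentIn _ _ ⊆ connectedComponentIn _ _
    rw [_root_.connectedComponentIn_eq h1]
    exact isPreconnected_connectedComponentIn.subset_connectedComponentIn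
      (mem_connectedComponentIn (hp' ρ₁))
      ((connectedComponentIn_subset _ _).trans (preimage_mono (sphericalDisk_mono a h12)))
  · rw [eq_empty_iff_forall_notMem]
    intro z hz
    rw [mem_iInter] at hz
    have hzH : z ∈ H := ((hU ⟨ρ₀, h₀⟩ le_rfl).subset (hz _)).1
    refine endModel_ne a (φ z) ?_
    rw [← E.apply_eq z hzH]
    exact eq_of_forall_mem_sphericalDisk fun ρ hρ =>
      connectedComponentIn_subset (Ψ ⁻¹' sphericalDisk a ρ) _ (hz ⟨ρ, hρ⟩)

/-- From Ψ = b - exp φ one gets Ψ' = -φ' exp φ and f = 1/Ψ'. The coordinate is -φ because the model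
lives on left half planes and hyperbolic tracts on right ones; over ∞, φ itself serves. -/
lemma deriv_mul_field_coe {b : ℂ} (E : LogEnd Ψ b φ H M) {z : ℂ} (hz : z ∈ H) :
    deriv (fun z => -φ z) z * field Ψ z = Complex.exp (-φ z) := by
  have h1 : HasDerivAt (fun ζ => affine (Ψ ζ)) (-(Complex.exp (φ z) * deriv φ z)) z := by
    refine ((E.differentiableAt z hz).hasDerivAt.cexp.const_sub b).congr_of_eventuallyEq ?_
    filter_upwards [E.isOpen.mem_nhds hz] with w hw
    rw [E.apply_eq w hw, affine_coe, endModel_coe]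
  have h2 := E.deriv_ne_zero z hz
  have h3 := Complex.exp_ne_zero (φ z)
  rw [(E.differentiableAt z hz).hasDerivAt.fun_neg.deriv, field, h1.deriv, Complex.exp_neg]
  field_simp

lemma deriv_mul_field_infty (E : LogEnd Ψ ∞ φ H M) {z : ℂ} (hz : z ∈ H) :
    deriv φ z * field Ψ z = Complex.exp (φ z) := by
  have h1 : HasDerivAt (fun ζ => affine (Ψ ζ)) (-(Complex.exp (-φ z) * -deriv φ z)) z := by
    refine ((E.differentiableAt z hz).hasDerivAt.fun_neg.cexp.fun_neg).congr_of_eventuallyEq ?_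
    filter_upwards [E.isOpen.mem_nhds hz] with w hw
    rw [E.apply_eq w hw, affine_coe, endModel_infty]
  have h2 := E.deriv_ne_zero z hz
  have h3 := Complex.exp_ne_zero (φ z)
  rw [field, h1.deriv, Complex.exp_neg]
  field_simp

lemma differentiableOn (E : LogEnd Ψ a φ H M) {W : Set ℂ} (hW : W ⊆ H) :
    DifferentiableOn ℂ φ W := fun z hz => (E.differentiableAt z (hW hz)).differentiableWithinAt

lemma isOpen_re_lt (E : LogEnd Ψ a φ H M) (c : ℝ) : IsOpen {z ∈ H | (φ z).re < c} :=
  ContinuousOn.isOpen_inter_preimage (t := {ζ : ℂ | ζ.re < c})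
    (E.differentiableOn Subset.rfl).continuousOn E.isOpen
    (isOpen_lt Complex.continuous_re continuous_const)

lemma bijOn_neg {s t : Set ℂ} (h : BijOn φ s t) : BijOn (fun z => -φ z) s {ζ | -ζ ∈ t} :=
  ⟨fun z hz => by simpa using h.mapsTo hz, fun z hz w hw hzw => h.injOn hz hw (neg_injective hzw),
    fun ζ hζ => by
      obtain ⟨z, hz, hzζ⟩ := h.surjOn hζ
      exact ⟨z, hz, by simp [hzζ]⟩⟩

lemma hasHyperbolicTracts {b : ℂ} (E : LogEnd Ψ b φ H M) {ρ₀ : ℝ} (h₀ : 0 < ρ₀)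
    (hgood : ∀ ρ, 0 < ρ → ρ ≤ ρ₀ → GoodRadius b M ρ) {U : Ioi (0 : ℝ) → Set ℂ}
    (hmono : Monotone U)
    (hU : ∀ ρ : Ioi (0 : ℝ), ρ.1 ≤ ρ₀ → U ρ = H ∩ Ψ ⁻¹' sphericalDisk b ρ) :
    HasHyperbolicTracts b U (field Ψ) := by
  refine ⟨⟨⟨ρ₀, h₀⟩, fun ρ hρ => ?_⟩, fun ρ => ?_⟩
  · have hρ' : ρ.1 ≤ ρ₀ := hρ
    rw [hU ρ hρ']
    exact ⟨fun z => -φ z, (E.differentiableOn inter_subset_left).fun_neg,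
      bijOn_neg (E.bijOn (hgood ρ ρ.2 hρ')), fun z hz => E.deriv_mul_field_coe hz.1⟩
  · set ρ₁ : Ioi (0 : ℝ) := ⟨min ρ.1 ρ₀, lt_min ρ.2 h₀⟩
    obtain ⟨L, hL⟩ := exists_endModel_mem b ρ₁.2
    -- With c ≥ L the half plane is mapped into the disk of radius ρ₁, and with c ≥ M it is covered
    -- by φ. The radius ρ₂ is then chosen so small that its preimage lies in this half plane.
    set c : ℝ := max L M
    obtain ⟨ρ₂, hρ₂, hre⟩ := exists_re_lt_of_endModel_mem b c
    refine ⟨⟨min ρ₂ ρ₀, lt_min hρ₂ h₀⟩, {z ∈ H | (φ z).re < -c}, ?_, ?_, E.isOpen_re_lt _, c, ?_⟩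
    · rw [hU _ (min_le_right _ _)]
      intro z hz
      refine ⟨hz.1, hre _ ?_⟩
      rw [← E.apply_eq z hz.1]
      exact sphericalDisk_mono _ (min_le_left _ _) hz.2
    · refine Subset.trans (fun z hz => ?_)
        (hmono (show ρ₁ ≤ ρ from Subtype.coe_le_coe.1 (min_le_left ρ.1 ρ₀)))
      rw [hU ρ₁ (min_le_right _ _)]
      refine ⟨hz.1, ?_⟩
      rw [mem_preimage, E.apply_eq z hz.1]
      exact hL _ (lt_of_lt_of_le hz.2 (neg_le_neg (le_max_left _ _)))
    · refine ⟨fun z => -φ z, (E.differentiableOn fun z hz => hz.1).fun_neg, ?_,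
        fun z hz => E.deriv_mul_field_coe hz.1⟩
      have h1 := bijOn_neg (E.bijOn_half_plane (neg_le_neg (le_max_right L M)))
      convert h1 using 1
      ext ζ
      simp [c]

lemma hasEllipticTracts (E : LogEnd Ψ ∞ φ H M) {ρ₀ : ℝ} (h₀ : 0 < ρ₀)
    (hgood : ∀ ρ, 0 < ρ → ρ ≤ ρ₀ → GoodRadius ∞ M ρ) {U : Ioi (0 : ℝ) → Set ℂ}
    (hU : ∀ ρ : Ioi (0 : ℝ), ρ.1 ≤ ρ₀ → U ρ = H ∩ Ψ ⁻¹' sphericalDisk ∞ ρ) :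
    HasEllipticTracts U (field Ψ) := by
  -- A radius strictly below π makes K positive, so the disk |w|² > K pulls back under -exp(-ζ) to
  -- exactly the half plane Re ζ < -(log K)/2.
  have h₁ : min ρ₀ 3 < Real.pi := (min_le_right _ _).trans_lt Real.pi_gt_three
  refine ⟨⟨min ρ₀ 3, lt_min h₀ (by norm_num)⟩, fun ρ hρ => ?_⟩
  have hρ' : ρ.1 ≤ min ρ₀ 3 := hρ
  have hρ₀ : ρ.1 ≤ ρ₀ := hρ'.trans (min_le_left _ _)
  have hπ : ρ.1 < Real.pi := hρ'.trans_lt h₁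
  have hpos : 0 < ρ.1 := ρ.2
  rw [hU ρ hρ₀]
  have hs : 0 < Real.sin (ρ / 2) := Real.sin_pos_of_pos_of_lt_pi (by linarith) (by linarith)
  have hs1 : Real.sin (ρ / 2) < 1 := by
    rw [← Real.sin_pi_div_two]
    exact Real.sin_lt_sin_of_lt_of_le_pi_div_two (by linarith) le_rfl (by linarith)
  set K : ℝ := 1 / Real.sin (ρ / 2) ^ 2 - 1
  have hK : 0 < K := by
    rw [sub_pos, lt_div_iff₀ (by positivity)]
    nlinarith
  refine ⟨E.isOpen_inter ρ, -(Real.log K / 2), φ, E.differentiableOn inter_subset_left, ?_,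
    fun z hz => E.deriv_mul_field_infty hz.1⟩
  convert E.bijOn (hgood ρ ρ.2 hρ₀) using 1
  ext ζ
  rw [mem_ofPred_eq, mem_ofPred_eq, coe_mem_sphericalDisk_infty hpos hπ.le, endModel_infty,
    norm_neg, Complex.norm_exp, ← Real.exp_nat_mul, ← Real.log_lt_iff_lt_exp hK, Complex.neg_re]
  push_cast
  constructor <;> intro h <;> linarith

end LogEnd

/-! ### The ends of a rational function of the exponential -/

section Cylinder

open Polynomial

variable {Ψ : ℂ → Sphere} {l : ℂ} {N D N' D' : ℂ[X]}

lemma exists_eq_X_pow_mul {p : ℂ[X]} (hp : p ≠ 0) (h0 : p.eval 0 = 0) :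
    ∃ k, 1 ≤ k ∧ ∃ q : ℂ[X], p = X ^ k * q ∧ q.eval 0 ≠ 0 := by
  obtain ⟨q, hq, hdvd⟩ := exists_eq_pow_rootMultiplicity_mul_and_not_dvd p hp 0
  refine ⟨p.rootMultiplicity 0, (rootMultiplicity_pos hp).2 h0, q, by simpa using hq, ?_⟩
  rwa [dvd_iff_isRoot] at hdvd

lemma analyticAt_eval (p : ℂ[X]) (w : ℂ) : AnalyticAt ℂ (fun w => p.eval w) w :=
  p.differentiable.analyticAt w

/-- A map of the form `pairMap N D (exp(l z))` has a logarithmic end at `exp(l z) = 0`. -/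
lemma exists_logEnd (hl : l ≠ 0) (h : NonconstantPair N D)
    (hΨ : ∀ z, Ψ z = pairMap N D (Complex.exp (l * z))) (M₀ : ℝ) :
    ∃ φ M M', M₀ ≤ M ∧ LogEnd Ψ (pairMap N D 0) φ {z | (l * z).re < -M} M' := by
  -- Local normal form at w = 0. The factor w^k g(w) is -D/N if the value there is ∞, and a - N/D if
  -- it is the finite number a; the model at any logarithm of it returns N/D.
  have key : ∃ k, 1 ≤ k ∧ ∃ g : ℂ → ℂ, AnalyticAt ℂ g 0 ∧ g 0 ≠ 0 ∧
      ∀ w ζ : ℂ, Complex.exp ζ = w ^ k * g w →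
        pairMap N D w = (endModel (pairMap N D 0) ζ : Sphere) := by
    by_cases hD : D.eval 0 = 0
    · have hN := h.eval_ne_zero 0 hD
      obtain ⟨k, hk, q, hq, hq0⟩ := exists_eq_X_pow_mul (neg_ne_zero.2 h.denom_ne_zero)
        (by rw [eval_neg, hD, neg_zero])
      refine ⟨k, hk, fun w => q.eval w / N.eval w,
        (analyticAt_eval q 0).div (analyticAt_eval N 0) hN, div_ne_zero hq0 hN, fun w ζ hζ => ?_⟩
      have h1 : -D.eval w = w ^ k * q.eval w := by
        have := congrArg (eval w) hq
        simpa using this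
      rw [← mul_div_assoc, ← h1] at hζ
      have hne := Complex.exp_ne_zero ζ
      have hNw : N.eval w ≠ 0 := fun h0 => hne (by rw [hζ, h0, div_zero])
      have hDw : D.eval w ≠ 0 := fun h0 => hne (by rw [hζ, h0, neg_zero, zero_div])
      rw [pairMap_of_eval_eq_zero hD, pairMap_of_eval_ne_zero hDw, endModel_infty, Complex.exp_neg,
        hζ, OnePoint.coe_eq_coe]
      field_simp
    · have hp := h.sub_ne_zero (N.eval 0 / D.eval 0)
      obtain ⟨k, hk, q, hq, hq0⟩ := exists_eq_X_pow_mul (neg_ne_zero.2 hp)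
        (by simp [div_mul_cancel₀ _ hD])
      refine ⟨k, hk, fun w => q.eval w / D.eval w,
        (analyticAt_eval q 0).div (analyticAt_eval D 0) hD, div_ne_zero hq0 hD, fun w ζ hζ => ?_⟩
      have h1 : N.eval 0 / D.eval 0 * D.eval w - N.eval w = w ^ k * q.eval w := by
        have := congrArg (eval w) hq
        simpa using this
      rw [← mul_div_assoc, ← h1] at hζ
      have hne := Complex.exp_ne_zero ζ
      have hDw : D.eval w ≠ 0 := fun h0 => hne (by rw [hζ, h0, div_zero])
      rw [pairMap_of_eval_ne_zero hD, pairMap_of_eval_ne_zero hDw, endModel_coe, hζ,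
        OnePoint.coe_eq_coe, sub_div, mul_div_cancel_right₀ _ hDw, sub_sub_cancel]
  obtain ⟨k, hk, g, hg, hg0, hexp⟩ := key
  obtain ⟨φ, M, M', hM, hdiff, hder, hφ, hlip, hsurj, hre⟩ := exists_log_coordinate hg hg0 hk M₀
  have hd : ∀ z : ℂ, HasDerivAt (fun z => l * z) l z := fun z => by
    simpa using (hasDerivAt_id z).const_mul l
  have hln : 0 < ‖l‖ := norm_pos_iff.2 hl
  have hcont : Continuous fun z : ℂ => (l * z).re := by fun_prop
  refine ⟨fun z => φ (l * z), M, M', hM, ⟨?_, isOpen_lt hcont continuous_const,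
    fun z hz => ?_, fun z hz => ?_, ⟨(2 / ‖l‖).toNNReal, fun z hz w hw => ?_⟩, fun ζ hζ => ?_, ?_,
    fun z hz => ?_⟩⟩
  · rw [funext hΨ]
    exact (continuous_pairMap h).comp (by fun_prop)
  · exact (hdiff _ hz).comp z (hd z).differentiableAt
  · have h1 : HasDerivAt (fun z => φ (l * z)) (deriv φ (l * z) * l) z :=
      (hdiff _ hz).hasDerivAt.comp z (hd z)
    rw [h1.deriv]
    exact mul_ne_zero (hder _ hz) hl
  · have h1 := hlip _ _ hz hw
    rw [← mul_sub, norm_mul] at h1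
    rw [Real.coe_toNNReal _ (by positivity), dist_eq_norm, dist_eq_norm, div_mul_eq_mul_div,
      le_div_iff₀ hln]
    linarith
  · obtain ⟨u, hu, hφu⟩ := hsurj ζ hζ
    have h1 : l * (u / l) = u := mul_div_cancel₀ u hl
    exact ⟨u / l, by rwa [mem_ofPred_eq, h1], by rw [h1, hφu]⟩
  · refine (closure_minimal (t := {z : ℂ | (l * z).re ≤ -M - 1}) (fun z hz => (hre _ hz.1 hz.2).le)
      (isClosed_le hcont continuous_const)).trans fun z hz => ?_
    have : (l * z).re ≤ -M - 1 := hz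
    change (l * z).re < -M
    linarith
  · rw [hΨ]
    exact hexp _ _ (hφ _ hz)

lemma forall_lt_or_forall_gt_of_isPreconnected {C : Set ℂ} (hC : IsPreconnected C) {f : ℂ → ℝ}
    (hf : Continuous f) {c : ℝ} (hc : ∀ z ∈ C, f z ≠ c) :
    (∀ z ∈ C, f z < c) ∨ (∀ z ∈ C, c < f z) := by
  by_contra! h
  obtain ⟨⟨x, hx, hxc⟩, y, hy, hyc⟩ := h
  obtain ⟨z, hz, hzc⟩ := hC.intermediate_value hy hx hf.continuousOn ⟨hyc, hxc⟩
  exact hc z hz hzc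

/-- A connected set which `pairMap N D (exp(l z))` maps to a small disk is bounded or contained in
one of two opposite half planes. -/
lemma exists_bounded_or_half_plane (hl : l ≠ 0) (h : NonconstantPair N D)
    (hΨ : ∀ z, Ψ z = pairMap N D (Complex.exp (l * z))) (a : Sphere) (M₀ : ℝ) :
    ∃ M, M₀ ≤ M ∧ ∃ ρ > 0, ∀ C : Set ℂ, IsPreconnected C → C ⊆ Ψ ⁻¹' sphericalDisk a ρ →
      Bornology.IsBounded C ∨ (∀ z ∈ C, (l * z).re < -M) ∨ (∀ z ∈ C, M < (l * z).re) := by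
  set S := {w | pairMap N D w = a}
  have hS : S.Finite := finite_pairMap_eq h a
  obtain ⟨B, hB⟩ := (hS.image fun w => |Real.log ‖w‖|).bddAbove
  have hB' : ∀ w ∈ S, |Real.log ‖w‖| ≤ B := fun w hw => hB ⟨w, hw, rfl⟩
  -- A direction θ different from the arguments of the finitely many fibre points, so that the
  -- radial segment misses the fibre.
  obtain ⟨θ, hθ, hθS⟩ := (Ioc_infinite (show -Real.pi < Real.pi by
    linarith [Real.pi_pos])).exists_notMem_finite (hS.image Complex.arg)
  -- Since M > B, the circles of radii exp(±M) miss the fibre.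
  set M : ℝ := max (max M₀ (B + 1)) 0
  have hM0 : M₀ ≤ M := (le_max_left _ _).trans (le_max_left _ _)
  have hMB : B + 1 ≤ M := (le_max_right _ _).trans (le_max_left _ _)
  have hM : 0 ≤ M := le_max_right _ _
  have hS1 : ∀ w ∈ S, ∀ x : ℝ, |x| = M → ‖w‖ ≠ Real.exp x := by
    intro w hw x hx hwx
    have := hB' w hw
    rw [hwx, Real.log_exp, hx] at this
    linarith
  set K : Set ℂ := (Metric.sphere 0 (Real.exp M) ∪ Metric.sphere 0 (Real.exp (-M))) ∪
    (fun x : ℝ => Complex.exp (x + θ * Complex.I)) '' Icc (-M) M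
  have hK : IsCompact K := ((isCompact_sphere _ _).union (isCompact_sphere _ _)).union
    (isCompact_Icc.image (by fun_prop))
  have haK : a ∉ pairMap N D '' K := by
    rintro ⟨w, hwK, hw⟩
    have hwS : w ∈ S := hw
    rcases hwK with (hw1 | hw1) | ⟨x, -, rfl⟩
    · exact hS1 w hwS M (abs_of_nonneg hM) (by simpa using hw1)
    · exact hS1 w hwS (-M) (by rw [abs_neg, abs_of_nonneg hM]) (by simpa using hw1)
    · refine hθS ⟨_, hwS, ?_⟩
      rw [← Complex.log_im, Complex.log_exp (by simpa using hθ.1) (by simpa using hθ.2)]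
      simp
  obtain ⟨ρ, hρ, hsub⟩ := exists_sphericalDisk_subset
    ((hK.image (continuous_pairMap h)).isClosed.isOpen_compl.mem_nhds haK)
  refine ⟨M, hM0, ρ, hρ, fun C hC hCsub => ?_⟩
  have hCK : ∀ z ∈ C, Complex.exp (l * z) ∉ K := fun z hz hzK =>
    hsub (hCsub hz) ⟨_, hzK, (hΨ z).symm⟩
  have hre : Continuous fun z : ℂ => (l * z).re := by fun_prop
  have him : Continuous fun z : ℂ => (l * z).im := by fun_prop
  rcases forall_lt_or_forall_gt_of_isPreconnected hC hre (c := -M)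
    (fun z hz h' => hCK z hz (Or.inl (Or.inr (by
    rw [mem_sphere_zero_iff_norm, Complex.norm_exp, h'])))) with h1 | h1
  · exact Or.inr (Or.inl h1)
  rcases forall_lt_or_forall_gt_of_isPreconnected hC hre (c := M)
    (fun z hz h' => hCK z hz (Or.inl (Or.inl (by
    rw [mem_sphere_zero_iff_norm, Complex.norm_exp, h'])))) with h2 | h2
  swap
  · exact Or.inr (Or.inr h2)
  left
  rcases C.eq_empty_or_nonempty with rfl | ⟨z₀, hz₀⟩
  · exact Bornology.isBounded_empty
  have hn : ∀ n : ℤ, ∀ z ∈ C, (l * z).im ≠ θ + n * (2 * Real.pi) := by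
    intro n z hz h'
    refine hCK z hz (Or.inr ⟨(l * z).re, ⟨(h1 z hz).le, (h2 z hz).le⟩, ?_⟩)
    refine Complex.exp_eq_exp_iff_exists_int.2 ⟨-n, ?_⟩
    refine Complex.ext ?_ ?_
    · simp
    · simp [h', Complex.mul_im]
  have hpi : (0 : ℝ) < 2 * Real.pi := by linarith [Real.pi_pos]
  -- The index of the strip of height 2π containing l z₀. By connectedness the image of C under
  -- multiplication by l cannot leave it, which bounds the imaginary part.
  set n : ℤ := ⌊((l * z₀).im - θ) / (2 * Real.pi)⌋
  have hn1 : θ + n * (2 * Real.pi) ≤ (l * z₀).im := by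
    have := (le_div_iff₀ hpi).1 (Int.floor_le (((l * z₀).im - θ) / (2 * Real.pi)))
    linarith
  have hn2 : (l * z₀).im < θ + (n + 1 : ℤ) * (2 * Real.pi) := by
    have := (div_lt_iff₀ hpi).1 (Int.lt_floor_add_one (((l * z₀).im - θ) / (2 * Real.pi)))
    push_cast
    linarith
  have h3 : ∀ z ∈ C, θ + n * (2 * Real.pi) < (l * z).im := by
    rcases forall_lt_or_forall_gt_of_isPreconnected hC him (hn n) with h | h
    · exact absurd (h z₀ hz₀) (not_lt.2 hn1)
    · exact h
  have h4 : ∀ z ∈ C, (l * z).im < θ + (n + 1 : ℤ) * (2 * Real.pi) := by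
    rcases forall_lt_or_forall_gt_of_isPreconnected hC him (hn (n + 1)) with h | h
    · exact h
    · exact absurd (h z₀ hz₀) (not_lt.2 hn2.le)
  have hln : 0 < ‖l‖ := norm_pos_iff.2 hl
  set c₁ := θ + n * (2 * Real.pi)
  set c₂ := θ + (n + 1 : ℤ) * (2 * Real.pi)
  refine isBounded_iff_forall_norm_le.2 ⟨(M + max |c₁| |c₂|) / ‖l‖, fun z hz => ?_⟩
  rw [le_div_iff₀ hln, mul_comm, ← norm_mul]
  refine (Complex.norm_le_abs_re_add_abs_im _).trans (add_le_add ?_ ?_)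
  · exact abs_le.2 ⟨(h1 z hz).le, (h2 z hz).le⟩
  · exact abs_le_max_abs_abs (h3 z hz).le (h4 z hz).le

lemma exists_notMem_sphericalDisk (h : NonconstantPair N D)
    (hΨ : ∀ z, Ψ z = pairMap N D (Complex.exp (l * z))) {a : Sphere} (ha : a ≠ pairMap N D 0) :
    ∃ M₀ : ℝ, ∃ ρ > 0, ∀ z, (l * z).re < -M₀ → Ψ z ∉ sphericalDisk a ρ := by
  obtain ⟨V, V', hV, hV', hdisj⟩ := t2_separation_nhds ha
  obtain ⟨ρ, hρ, hsub⟩ := exists_sphericalDisk_subset hV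
  obtain ⟨δ, hδ, hball⟩ := Metric.mem_nhds_iff.1 ((continuous_pairMap h).continuousAt hV')
  refine ⟨-Real.log δ, ρ, hρ, fun z hz hmem => ?_⟩
  refine hdisj.le_bot ⟨hsub hmem, ?_⟩
  rw [hΨ]
  refine hball ?_
  rw [mem_ball_zero_iff, Complex.norm_exp, ← Real.lt_log_iff_exp_lt hδ]
  linarith

lemma isAsymptoticValue_pairMap_zero (hl : l ≠ 0) (h : NonconstantPair N D)
    (hΨ : ∀ z, Ψ z = pairMap N D (Complex.exp (l * z))) :
    IsAsymptoticValue Ψ (pairMap N D 0) := by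
  have hln : 0 < ‖l‖ := norm_pos_iff.2 hl
  refine ⟨fun τ => ((-τ : ℝ) : ℂ) / l, by fun_prop, ?_, ?_⟩
  · rw [← Metric.cobounded_eq_cocompact, ← tendsto_norm_atTop_iff_cobounded]
    have h1 : Tendsto (fun τ : ℝ => |τ| / ‖l‖) atTop atTop :=
      tendsto_abs_atTop_atTop.atTop_div_const hln
    refine h1.congr fun τ => ?_
    rw [norm_div, Complex.norm_real, Real.norm_eq_abs, abs_neg]
  · have h1 : Tendsto (fun τ : ℝ => ((Real.exp (-τ) : ℝ) : ℂ)) atTop (𝓝 0) := by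
      rw [← Complex.ofReal_zero]
      exact (Complex.continuous_ofReal.tendsto 0).comp
        (Real.tendsto_exp_atBot.comp tendsto_neg_atTop_atBot)
    refine (((continuous_pairMap h).tendsto 0).comp h1).congr fun τ => ?_
    rw [hΨ, mul_div_cancel₀ _ hl, Function.comp_apply, Complex.ofReal_exp]

/-- `Ψ` is a rational function of `exp(l z)` and of `exp(-l z)`. -/
structure CylinderMap (Ψ : ℂ → Sphere) (l : ℂ) (N D N' D' : ℂ[X]) : Prop where
  ne_zero : l ≠ 0
  pair : NonconstantPair N D
  pair' : NonconstantPair N' D'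
  apply_eq : ∀ z, Ψ z = pairMap N D (Complex.exp (l * z))
  apply_eq' : ∀ z, Ψ z = pairMap N' D' (Complex.exp (-l * z))

lemma CylinderMap.continuous (S : CylinderMap Ψ l N D N' D') : Continuous Ψ := by
  rw [funext S.apply_eq]
  exact (continuous_pairMap S.pair).comp (by fun_prop)

/-- An unbounded connected set which `Ψ` maps to a small disk is contained in a half plane at one
of the ends, and the center of the disk is the value there. -/
lemma CylinderMap.exists_half_plane (S : CylinderMap Ψ l N D N' D') (a : Sphere) (M₀ : ℝ) :
    ∃ ρ₀ > 0, ∀ ρ ≤ ρ₀, ∀ C : Set ℂ, IsPreconnected C → C.Nonempty →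
      C ⊆ Ψ ⁻¹' sphericalDisk a ρ → ¬ Bornology.IsBounded C →
      (a = pairMap N D 0 ∧ ∀ z ∈ C, (l * z).re < -M₀) ∨
        (a = pairMap N' D' 0 ∧ ∀ z ∈ C, (-l * z).re < -M₀) := by
  have h0 : ∃ M : ℝ, ∃ ρ > 0, a = pairMap N D 0 ∨
      ∀ z, (l * z).re < -M → Ψ z ∉ sphericalDisk a ρ := by
    by_cases ha : a = pairMap N D 0
    · exact ⟨0, 1, one_pos, Or.inl ha⟩
    · obtain ⟨M, ρ, hρ, h⟩ := exists_notMem_sphericalDisk S.pair S.apply_eq ha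
      exact ⟨M, ρ, hρ, Or.inr h⟩
  have h1 : ∃ M : ℝ, ∃ ρ > 0, a = pairMap N' D' 0 ∨
      ∀ z, (-l * z).re < -M → Ψ z ∉ sphericalDisk a ρ := by
    by_cases ha : a = pairMap N' D' 0
    · exact ⟨0, 1, one_pos, Or.inl ha⟩
    · obtain ⟨M, ρ, hρ, h⟩ := exists_notMem_sphericalDisk S.pair' S.apply_eq' ha
      exact ⟨M, ρ, hρ, Or.inr h⟩
  obtain ⟨M₁, ρ₁, hρ₁, h0⟩ := h0
  obtain ⟨M₂, ρ₂, hρ₂, h1⟩ := h1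
  obtain ⟨M, hM, ρ₃, hρ₃, hC⟩ := exists_bounded_or_half_plane S.ne_zero S.pair S.apply_eq a
    (max M₀ (max M₁ M₂))
  have hMM₀ : M₀ ≤ M := (le_max_left _ _).trans hM
  have hMM₁ : M₁ ≤ M := ((le_max_left _ _).trans (le_max_right _ _)).trans hM
  have hMM₂ : M₂ ≤ M := ((le_max_right _ _).trans (le_max_right _ _)).trans hM
  refine ⟨min ρ₃ (min ρ₁ ρ₂), by positivity, fun ρ hρ C hconn hne hsub hunb => ?_⟩
  have hsub' : ∀ ρ', min ρ₃ (min ρ₁ ρ₂) ≤ ρ' → C ⊆ Ψ ⁻¹' sphericalDisk a ρ' := fun ρ' h' =>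
    hsub.trans (preimage_mono (sphericalDisk_mono a (hρ.trans h')))
  obtain ⟨z, hz⟩ := hne
  rcases hC C hconn (hsub' _ (min_le_left _ _)) with hb | hl | hr
  · exact absurd hb hunb
  · refine Or.inl ⟨h0.resolve_right fun h => h z (by linarith [hl z hz]) ?_,
      fun z hz => by linarith [hl z hz]⟩
    exact hsub' _ ((min_le_right _ _).trans (min_le_left _ _)) hz
  · have hr' : ∀ z ∈ C, (-l * z).re < -M := fun z hz => by
      rw [neg_mul, Complex.neg_re]
      linarith [hr z hz]
    refine Or.inr ⟨h1.resolve_right fun h => h z (by linarith [hr' z hz]) ?_,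
      fun z hz => by linarith [hr' z hz]⟩
    exact hsub' _ ((min_le_right _ _).trans (min_le_right _ _)) hz

/-- A tail of an asymptotic path is an unbounded connected set mapped into a small disk about the
limit, so it lies at one of the ends and the limit is the value there. -/
lemma CylinderMap.setOf_isAsymptoticValue (S : CylinderMap Ψ l N D N' D') :
    {a | IsAsymptoticValue Ψ a} = {pairMap N D 0, pairMap N' D' 0} := by
  refine Subset.antisymm ?_ ?_
  · rintro a ⟨α, hα, hinf, hlim⟩
    obtain ⟨ρ₀, hρ₀, hC⟩ := S.exists_half_plane a 0
    obtain ⟨τ, hτ⟩ := (((hlim.eventually (sphericalDisk_mem_nhds a hρ₀)).and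
      (eventually_gt_atTop 0)).exists_forall_of_atTop)
    have hpos : 0 < τ := (hτ τ le_rfl).2
    have hunb : ¬ Bornology.IsBounded (α '' Ici τ) := by
      intro hb
      have h1 := hinf.eventually hb.isCompact_closure.compl_mem_cocompact
      obtain ⟨x, hx, hxτ⟩ := (h1.and (eventually_ge_atTop τ)).exists
      exact hx (subset_closure ⟨x, hxτ, rfl⟩)
    rcases hC ρ₀ le_rfl (α '' Ici τ)
      (isPreconnected_Ici.image _ (hα.mono fun x hx => hpos.trans_le hx))
      (nonempty_Ici.image _) (by rintro _ ⟨x, hx, rfl⟩; exact (hτ x hx).1) hunb with h | h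
    · exact Or.inl h.1
    · exact Or.inr h.1
  · rintro a (rfl | rfl)
    · exact isAsymptoticValue_pairMap_zero S.ne_zero S.pair S.apply_eq
    · exact isAsymptoticValue_pairMap_zero (neg_ne_zero.2 S.ne_zero) S.pair' S.apply_eq'

end Cylinder

/-! ### Transcendental singularities -/

namespace IsTranscendentalSingularity

variable {Ψ : ℂ → Sphere} {a : Sphere} {U U' : Ioi (0 : ℝ) → Set ℂ}

lemma subset_preimage (h : IsTranscendentalSingularity Ψ a U) (ρ : Ioi (0 : ℝ)) :
    U ρ ⊆ Ψ ⁻¹' sphericalDisk a ρ := by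
  obtain ⟨z, -, hU⟩ := h.1 ρ
  rw [hU]
  exact connectedComponentIn_subset _ _

lemma nonempty (h : IsTranscendentalSingularity Ψ a U) (ρ : Ioi (0 : ℝ)) : (U ρ).Nonempty := by
  obtain ⟨z, hz, hU⟩ := h.1 ρ
  rw [hU]
  exact ⟨z, mem_connectedComponentIn hz⟩

lemma isPreconnected (h : IsTranscendentalSingularity Ψ a U) (ρ : Ioi (0 : ℝ)) :
    IsPreconnected (U ρ) := by
  obtain ⟨z, -, hU⟩ := h.1 ρ
  rw [hU]
  exact isPreconnected_connectedComponentIn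

lemma eq_connectedComponentIn (h : IsTranscendentalSingularity Ψ a U) {ρ : Ioi (0 : ℝ)} {z : ℂ}
    (hz : z ∈ U ρ) : U ρ = connectedComponentIn (Ψ ⁻¹' sphericalDisk a ρ) z := by
  obtain ⟨w, -, hU⟩ := h.1 ρ
  rw [hU] at hz ⊢
  exact connectedComponentIn_eq hz

/-- By monotonicity, a point of U at a small radius determines the component at every larger radius.
-/
lemma eq_of_forall_le (h : IsTranscendentalSingularity Ψ a U)
    (h' : IsTranscendentalSingularity Ψ a U') {ρ₀ : Ioi (0 : ℝ)} (heq : ∀ ρ ≤ ρ₀, U ρ = U' ρ) :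
    U = U' := by
  funext ρ
  rcases le_total ρ ρ₀ with hρ | hρ
  · exact heq ρ hρ
  · obtain ⟨z, hz⟩ := h.nonempty ρ₀
    have hz' : z ∈ U' ρ₀ := heq ρ₀ le_rfl ▸ hz
    rw [h.eq_connectedComponentIn (h.2.1 hρ hz), h'.eq_connectedComponentIn (h'.2.1 hρ hz')]

/-- Otherwise the closures of the small U(ρ) are compact and nested, hence have a common point z,
and Ψ(z) = a by continuity. Adjoining z to U(ρ) keeps it connected and inside the preimage of the
disk, so z lies in every U(ρ), contradicting the empty intersection. -/
lemma not_isBounded (hΨ : Continuous Ψ) (h : IsTranscendentalSingularity Ψ a U)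
    (ρ₁ : Ioi (0 : ℝ)) : ¬ Bornology.IsBounded (U ρ₁) := by
  intro hb
  have hne : (⋂ ρ : Ioi (0 : ℝ), closure (U (min ρ ρ₁))).Nonempty := by
    refine IsCompact.nonempty_iInter_of_directed_nonempty_isCompact_isClosed _ ?_ ?_ ?_ ?_
    · intro ρ ρ'
      refine ⟨min ρ ρ', ?_, ?_⟩
      · exact closure_mono (h.2.1 (min_le_min_right _ (min_le_left _ _)))
      · exact closure_mono (h.2.1 (min_le_min_right _ (min_le_right _ _)))
    · exact fun ρ => (h.nonempty _).closure
    · exact fun ρ => (hb.subset (h.2.1 (min_le_right _ _))).isCompact_closure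
    · exact fun ρ => isClosed_closure
  obtain ⟨z, hz⟩ := hne
  have hz' : ∀ ρ, z ∈ closure (U ρ) := fun ρ =>
    closure_mono (h.2.1 (min_le_left _ _)) (mem_iInter.1 hz ρ)
  have hza : Ψ z = a := by
    by_contra hne
    obtain ⟨V, V', hV, hV', hdisj⟩ := t2_separation_nhds hne
    obtain ⟨ρ, hρ, hsub⟩ := exists_sphericalDisk_subset hV'
    obtain ⟨w, hw, hwU⟩ := mem_closure_iff_nhds.1 (hz' ⟨ρ, hρ⟩) _ (hΨ.continuousAt hV)
    exact hdisj.le_bot ⟨hw, hsub (h.subset_preimage _ hwU)⟩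
  have hmem : z ∈ ⋂ ρ, U ρ := by
    rw [mem_iInter]
    intro ρ
    obtain ⟨w, hw⟩ := h.nonempty ρ
    have hzρ : z ∈ Ψ ⁻¹' sphericalDisk a ρ := by
      rw [mem_preimage, hza]
      exact mem_sphericalDisk_self a ρ.2
    have hpre : IsPreconnected (insert z (U ρ)) :=
      (h.isPreconnected ρ).subset_closure (subset_insert _ _)
        (insert_subset (hz' ρ) subset_closure)
    rw [h.eq_connectedComponentIn hw]
    exact hpre.subset_connectedComponentIn (mem_insert_of_mem _ hw)
      (insert_subset hzρ (h.subset_preimage ρ)) (mem_insert _ _)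
  rw [h.2.2] at hmem
  exact hmem

lemma eq_inter_of_logEnd {φ : ℂ → ℂ} {H : Set ℂ} {M : ℝ} (E : LogEnd Ψ a φ H M)
    (h : IsTranscendentalSingularity Ψ a U) {ρ₀ : Ioi (0 : ℝ)}
    (hgood : ∀ ρ, 0 < ρ → ρ ≤ ρ₀.1 → GoodRadius a M ρ) (hH : U ρ₀ ⊆ H) {ρ : Ioi (0 : ℝ)}
    (hρ : ρ ≤ ρ₀) : U ρ = H ∩ Ψ ⁻¹' sphericalDisk a ρ := by
  obtain ⟨z, hz⟩ := h.nonempty ρ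
  rw [h.eq_connectedComponentIn hz]
  exact E.connectedComponentIn_eq (hgood ρ ρ.2 hρ) ⟨hH (h.2.1 hρ hz), h.subset_preimage ρ hz⟩

end IsTranscendentalSingularity

open Polynomial in
-- A singularity is unbounded, so at small radii it is caught in one of the two half planes, where
-- the only component is the end; small radii determine the rest.
lemma CylinderMap.exists_transcendentalSingularities {Ψ : ℂ → Sphere} {l : ℂ} {N D N' D' : ℂ[X]}
    (S : CylinderMap Ψ l N D N' D') :
    (∃ U₀ U₁ : Ioi (0 : ℝ) → Set ℂ, U₀ ≠ U₁ ∧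
      {s : Sphere × (Ioi (0 : ℝ) → Set ℂ) | IsTranscendentalSingularity Ψ s.1 s.2} =
        {(pairMap N D 0, U₀), (pairMap N' D' 0, U₁)}) ∧
    ∀ (a : Sphere) (U : Ioi (0 : ℝ) → Set ℂ), IsTranscendentalSingularity Ψ a U →
      ∃ φ H M, LogEnd Ψ a φ H M ∧ ∃ ρ₀ : Ioi (0 : ℝ),
        (∀ ρ, 0 < ρ → ρ ≤ ρ₀.1 → GoodRadius a M ρ) ∧
          ∀ ρ : Ioi (0 : ℝ), ρ.1 ≤ ρ₀.1 → U ρ = H ∩ Ψ ⁻¹' sphericalDisk a ρ := by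
  -- The lower bound 0 for M₀ and M₁ makes the two half planes disjoint, which distinguishes the
  -- singularities even when their values agree.
  obtain ⟨φ₀, M₀, B₀, hM₀, E₀⟩ := exists_logEnd S.ne_zero S.pair S.apply_eq 0
  obtain ⟨φ₁, M₁, B₁, hM₁, E₁⟩ := exists_logEnd (neg_ne_zero.2 S.ne_zero) S.pair' S.apply_eq' 0
  obtain ⟨ρ₀, hρ₀, hgood₀⟩ := exists_goodRadius (pairMap N D 0) B₀
  obtain ⟨ρ₁, hρ₁, hgood₁⟩ := exists_goodRadius (pairMap N' D' 0) B₁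
  obtain ⟨U₀, hU₀, hU₀'⟩ := E₀.exists_isTranscendentalSingularity hρ₀ hgood₀
  obtain ⟨U₁, hU₁, hU₁'⟩ := E₁.exists_isTranscendentalSingularity hρ₁ hgood₁
  have hne : U₀ ≠ U₁ := by
    intro heq
    set ρ : Ioi (0 : ℝ) := ⟨min ρ₀ ρ₁, lt_min hρ₀ hρ₁⟩
    obtain ⟨z, hz⟩ := hU₀.nonempty ρ
    have h0 : (l * z).re < -M₀ := ((hU₀' ρ (min_le_left _ _)).subset hz).1
    have h1 : (-l * z).re < -M₁ := ((hU₁' ρ (min_le_right _ _)).subset (heq ▸ hz)).1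
    rw [neg_mul, Complex.neg_re] at h1
    linarith
  have hcases : ∀ (a : Sphere) (U : Ioi (0 : ℝ) → Set ℂ), IsTranscendentalSingularity Ψ a U →
      (a, U) = (pairMap N D 0, U₀) ∨ (a, U) = (pairMap N' D' 0, U₁) := by
    intro a U hU
    obtain ⟨ρ₂, hρ₂, hC⟩ := S.exists_half_plane a (max M₀ M₁)
    have h0 : min ρ₂ (min ρ₀ ρ₁) ≤ ρ₀ := (min_le_right _ _).trans (min_le_left _ _)
    have h1 : min ρ₂ (min ρ₀ ρ₁) ≤ ρ₁ := (min_le_right _ _).trans (min_le_right _ _)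
    set ρ : Ioi (0 : ℝ) := ⟨min ρ₂ (min ρ₀ ρ₁), lt_min hρ₂ (lt_min hρ₀ hρ₁)⟩
    rcases hC ρ.1 (min_le_left _ _) (U ρ) (hU.isPreconnected ρ) (hU.nonempty ρ)
      (hU.subset_preimage ρ) (hU.not_isBounded S.continuous ρ) with ⟨rfl, hH⟩ | ⟨rfl, hH⟩
    · left
      rw [hU.eq_of_forall_le hU₀ (ρ₀ := ρ) fun ρ' hρ' => ?_]
      have hle : ρ'.1 ≤ ρ₀ := le_trans (Subtype.coe_le_coe.2 hρ') h0
      rw [hU₀' ρ' hle]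
      exact hU.eq_inter_of_logEnd E₀ (fun ρ'' hp hl => hgood₀ ρ'' hp (hl.trans h0))
        (fun z hz => (hH z hz).trans_le (neg_le_neg (le_max_left _ _))) hρ'
    · right
      rw [hU.eq_of_forall_le hU₁ (ρ₀ := ρ) fun ρ' hρ' => ?_]
      have hle : ρ'.1 ≤ ρ₁ := le_trans (Subtype.coe_le_coe.2 hρ') h1
      rw [hU₁' ρ' hle]
      exact hU.eq_inter_of_logEnd E₁ (fun ρ'' hp hl => hgood₁ ρ'' hp (hl.trans h1))
        (fun z hz => (hH z hz).trans_le (neg_le_neg (le_max_right _ _))) hρ'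
  refine ⟨⟨U₀, U₁, hne, Subset.antisymm (fun s hs => hcases s.1 s.2 hs) ?_⟩, fun a U hU => ?_⟩
  · rintro s (rfl | rfl)
    exacts [hU₀, hU₁]
  · rcases hcases a U hU with h | h <;> obtain ⟨rfl, rfl⟩ := Prod.mk.inj h
    · exact ⟨_, _, _, E₀, ⟨ρ₀, hρ₀⟩, hgood₀, hU₀'⟩
    · exact ⟨_, _, _, E₁, ⟨ρ₁, hρ₁⟩, hgood₁, hU₁'⟩

lemma LogEnd.isLogarithmic_and_tracts {Ψ : ℂ → Sphere} {a : Sphere} {φ : ℂ → ℂ} {H : Set ℂ} {M : ℝ}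
    (E : LogEnd Ψ a φ H M) {U : Ioi (0 : ℝ) → Set ℂ} (hmono : Monotone U) {ρ₀ : Ioi (0 : ℝ)}
    (hgood : ∀ ρ, 0 < ρ → ρ ≤ ρ₀.1 → GoodRadius a M ρ)
    (hU : ∀ ρ : Ioi (0 : ℝ), ρ.1 ≤ ρ₀.1 → U ρ = H ∩ Ψ ⁻¹' sphericalDisk a ρ) :
    IsLogarithmic Ψ a U ∧
      (∀ b : ℂ, a = (b : Sphere) → HasHyperbolicTracts b U (field Ψ)) ∧
      (a = ∞ → HasEllipticTracts U (field Ψ)) := by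
  refine ⟨⟨ρ₀, ?_⟩, ?_, ?_⟩
  · rw [hU ρ₀ le_rfl]
    exact E.isUniversalCovering (hgood _ ρ₀.2 le_rfl)
  · rintro b rfl
    exact E.hasHyperbolicTracts ρ₀.2 hgood hmono hU
  · rintro rfl
    exact E.hasEllipticTracts ρ₀.2 hgood hU

/-! ### The vector field -/

section VectorField

open Polynomial

variable {Ψ : ℂ → Sphere} {l : ℂ} {N D : ℂ[X]}

/-- The Wronskian of coprime polynomials vanishes only if both derivatives do; in characteristic 0
both would then be constant. -/
lemma derivative_mul_sub_ne_zero (h : IsCoprime N D)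
    (hr : 1 ≤ max N.natDegree D.natDegree) : derivative N * D - N * derivative D ≠ 0 := by
  intro h0
  have h1 : N.wronskian D = 0 := by
    rw [wronskian, ← neg_eq_zero, neg_sub]
    exact h0
  obtain ⟨hN, hD⟩ := h.wronskian_eq_zero_iff.1 h1
  rw [derivative_eq_zero] at hN hD
  rw [hN, hD] at hr
  simp at hr

lemma hasDerivAt_exp_mul (l z : ℂ) :
    HasDerivAt (fun z => Complex.exp (l * z)) (Complex.exp (l * z) * l) z := by
  have h1 : HasDerivAt (fun z => l * z) l z := by simpa using (hasDerivAt_id z).const_mul l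
  exact h1.cexp

lemma analyticAt_exp_mul (l z : ℂ) : AnalyticAt ℂ (fun z => Complex.exp (l * z)) z := by
  fun_prop

lemma exp_mul_tendsto_nhdsNE (hl : l ≠ 0) (z : ℂ) :
    Tendsto (fun z => Complex.exp (l * z)) (𝓝[≠] z) (𝓝[≠] Complex.exp (l * z)) :=
  (hasDerivAt_exp_mul l z).tendsto_nhdsNE (mul_ne_zero (Complex.exp_ne_zero _) hl)

lemma meromorphicAt_eval_div (N D : ℂ[X]) (w : ℂ) :
    MeromorphicAt (fun w => N.eval w / D.eval w) w :=
  (analyticAt_eval N w).meromorphicAt.fun_div (analyticAt_eval D w).meromorphicAt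

lemma eventually_eval_ne_zero {p : ℂ[X]} (hp : p ≠ 0) (w : ℂ) : ∀ᶠ v in 𝓝[≠] w, p.eval v ≠ 0 := by
  have h1 : (p.rootSet ℂ \ {w})ᶜ ∈ 𝓝 w :=
    ((p.rootSet_finite ℂ).subset sdiff_subset).isClosed.isOpen_compl.mem_nhds (by simp)
  filter_upwards [mem_nhdsWithin_of_mem_nhds h1, self_mem_nhdsWithin] with v hv hvw h0
  exact hv ⟨by rw [mem_rootSet]; exact ⟨hp, by simpa using h0⟩, hvw⟩

lemma affine_eq (hΨ : ∀ z, Ψ z = pairMap N D (Complex.exp (l * z))) :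
    (fun z => affine (Ψ z)) =
      (fun w => N.eval w / D.eval w) ∘ fun z => Complex.exp (l * z) := by
  funext z
  rw [hΨ, affine_pairMap, Function.comp_apply]

lemma hasDerivAt_affine (hΨ : ∀ z, Ψ z = pairMap N D (Complex.exp (l * z))) {z : ℂ}
    (hD : D.eval (Complex.exp (l * z)) ≠ 0) :
    HasDerivAt (fun z => affine (Ψ z)) ((derivative N * D - N * derivative D).eval
      (Complex.exp (l * z)) / D.eval (Complex.exp (l * z)) ^ 2 * (Complex.exp (l * z) * l)) z := by
  rw [affine_eq hΨ]
  have h1 := ((N.hasDerivAt (Complex.exp (l * z))).fun_div (D.hasDerivAt _) hD).comp z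
    (hasDerivAt_exp_mul l z)
  simpa using h1

lemma meromorphicAt_affine (hΨ : ∀ z, Ψ z = pairMap N D (Complex.exp (l * z))) (z : ℂ) :
    MeromorphicAt (fun z => affine (Ψ z)) z := by
  rw [affine_eq hΨ]
  exact (meromorphicAt_eval_div N D _).comp_analyticAt (analyticAt_exp_mul l z)

lemma field_eq_inv (Ψ : ℂ → Sphere) : field Ψ = (deriv fun z => affine (Ψ z))⁻¹ := rfl

lemma meromorphicAt_field (hΨ : ∀ z, Ψ z = pairMap N D (Complex.exp (l * z))) (z : ℂ) :
    MeromorphicAt (field Ψ) z := by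
  rw [field_eq_inv]
  exact (meromorphicAt_affine hΨ z).deriv.inv

lemma eventually_deriv_affine_ne_zero (hl : l ≠ 0) (hD : D ≠ 0)
    (hW : derivative N * D - N * derivative D ≠ 0)
    (hΨ : ∀ z, Ψ z = pairMap N D (Complex.exp (l * z))) (z : ℂ) :
    ∀ᶠ ζ in 𝓝[≠] z, deriv (fun z => affine (Ψ z)) ζ ≠ 0 := by
  filter_upwards [(exp_mul_tendsto_nhdsNE hl z).eventually (eventually_eval_ne_zero hD _),
    (exp_mul_tendsto_nhdsNE hl z).eventually (eventually_eval_ne_zero hW _)] with ζ h1 h2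
  rw [(hasDerivAt_affine hΨ h1).deriv]
  exact mul_ne_zero (div_ne_zero h2 (pow_ne_zero _ h1)) (mul_ne_zero (Complex.exp_ne_zero _) hl)

lemma periodic_field {T : ℂ} (h : Function.Periodic Ψ T) : Function.Periodic (field Ψ) T := by
  intro z
  have h1 : (fun ζ => affine (Ψ (ζ + T))) = fun ζ => affine (Ψ ζ) := by
    funext ζ
    rw [h]
  rw [field, field, ← deriv_comp_add_const (fun ζ => affine (Ψ ζ)) T z, h1]

/-- A periodic function which is meromorphic at infinity is constant. -/
lemma eq_of_periodic_of_meromorphicAt {f : ℂ → ℂ} {T : ℂ} (hT : T ≠ 0) (hf : Function.Periodic f T)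
    (hm : MeromorphicAt (fun w => -w ^ 2 * f w⁻¹) 0) : ∃ c, ∀ z, f z = c := by
  have h1 : MeromorphicAt (fun w => f w⁻¹) 0 := by
    have h2 : MeromorphicAt (fun w : ℂ => (-w ^ 2)⁻¹ * (-w ^ 2 * f w⁻¹)) 0 :=
      (by fun_prop : MeromorphicAt (fun w : ℂ => (-w ^ 2)⁻¹) 0).fun_mul hm
    refine h2.congr ?_
    filter_upwards [self_mem_nhdsWithin] with w hw
    have hw0 : w ≠ 0 := hw
    exact inv_mul_cancel_left₀ (neg_ne_zero.2 (pow_ne_zero 2 hw0)) _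
  -- Along 1/(z + nT) → 0 the function f(1/w) has the constant value f(z). This excludes a pole at w
  -- = 0, and otherwise identifies f(z) with the limit there, which does not depend on z.
  have hseq : ∀ z : ℂ, Tendsto (fun n : ℕ => (z + n * T)⁻¹) atTop (𝓝[≠] 0) := by
    intro z
    have h2 : Tendsto (fun n : ℕ => z + n * T) atTop (Bornology.cobounded ℂ) := by
      rw [← tendsto_norm_atTop_iff_cobounded]
      have h3 : Tendsto (fun n : ℕ => (n : ℝ) * ‖T‖ + -‖z‖) atTop atTop :=
        tendsto_atTop_add_const_right _ _
          (tendsto_natCast_atTop_atTop.atTop_mul_const (norm_pos_iff.2 hT))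
      refine tendsto_atTop_mono (fun n => ?_) h3
      have h4 := norm_sub_le (z + n * T) z
      rw [add_sub_cancel_left, norm_mul, Complex.norm_natCast] at h4
      linarith
    refine tendsto_nhdsWithin_iff.2 ⟨tendsto_inv₀_cobounded.comp h2, ?_⟩
    filter_upwards [h2 (Bornology.isBounded_def.1 (Bornology.isBounded_singleton (x := 0)))]
      with n hn
    exact inv_ne_zero hn
  have hval : ∀ (z : ℂ) (n : ℕ), f ((z + n * T)⁻¹)⁻¹ = f z := fun z n => by
    rw [inv_inv]
    exact hf.nat_mul n z
  rcases lt_or_ge (meromorphicOrderAt (fun w => f w⁻¹) 0) 0 with h2 | h2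
  · have h3 := (tendsto_cobounded_of_meromorphicOrderAt_neg h2).comp (hseq 0)
    have h4 : Tendsto (fun _ : ℕ => f 0) atTop (Bornology.cobounded ℂ) :=
      h3.congr fun n => hval 0 n
    rw [← tendsto_norm_atTop_iff_cobounded] at h4
    exact absurd h4 (not_tendsto_const_atTop _ _)
  · obtain ⟨c, hc⟩ := tendsto_nhds_of_meromorphicOrderAt_nonneg h1 h2
    refine ⟨c, fun z => ?_⟩
    have h3 : Tendsto (fun _ : ℕ => f z) atTop (𝓝 c) :=
      (hc.comp (hseq z)).congr fun n => hval z n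
    exact tendsto_nhds_unique tendsto_const_nhds h3

lemma setOf_isEssentialSingularity_field {T : ℂ} (hT : T ≠ 0) (hper : Function.Periodic Ψ T)
    (hl : l ≠ 0) (hD : D ≠ 0) (hW : derivative N * D - N * derivative D ≠ 0)
    (hΨ : ∀ z, Ψ z = pairMap N D (Complex.exp (l * z))) :
    {p : Sphere | IsEssentialSingularity (field Ψ) p} = {∞} := by
  refine Subset.antisymm (fun p hp => ?_) (singleton_subset_iff.2 ?_)
  · induction p using OnePoint.rec with
    | infty => rfl
    | coe z => exact absurd (meromorphicAt_field hΨ z) hp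
  · intro hm
    obtain ⟨c, hc⟩ := eq_of_periodic_of_meromorphicAt hT (periodic_field hper) hm
    have hd : ∀ z, deriv (fun z => affine (Ψ z)) z = c⁻¹ := fun z => by
      rw [← hc z, field, inv_inv]
    obtain ⟨z, hz⟩ := (eventually_deriv_affine_ne_zero hl hD hW hΨ 0).exists
    rw [hd] at hz
    -- As `deriv` is 0 where a function is not differentiable, a nonzero constant `deriv` rules out
    -- poles of Ψ.
    have hdiff : Differentiable ℂ fun z => affine (Ψ z) := fun z =>
      differentiableAt_of_deriv_ne_zero (by rwa [hd])
    have hlin : ∀ z, HasDerivAt (fun z => affine (Ψ z) - c⁻¹ * z) 0 z := fun z => by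
      have h1 : HasDerivAt (fun z : ℂ => c⁻¹ * z) c⁻¹ z := by
        simpa using (hasDerivAt_id z).const_mul c⁻¹
      simpa [hd] using (hdiff z).hasDerivAt.fun_sub h1
    have h1 := is_const_of_deriv_eq_zero (fun z => (hlin z).differentiableAt)
      (fun z => (hlin z).deriv) T 0
    have h2 : Ψ T = Ψ 0 := by simpa using hper 0
    rw [h2] at h1
    simp only [mul_zero, sub_zero, sub_eq_self, mul_eq_zero] at h1
    exact h1.elim hz hT

/-! ### Poles and zeros on the fibres of the exponential -/

lemma accumulatesAtInfty_exp_eq (hl : l ≠ 0) {w : ℂ} (hw : w ≠ 0) :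
    AccumulatesAtInfty {z | Complex.exp (l * z) = w} := by
  intro K
  have hc : 2 * Real.pi * Complex.I / l ≠ 0 := div_ne_zero Complex.two_pi_I_ne_zero hl
  have hinj : Function.Injective fun n : ℕ =>
      Complex.log w / l + n * (2 * Real.pi * Complex.I / l) := by
    intro n m hnm
    have := mul_right_cancel₀ hc (add_left_cancel hnm)
    exact_mod_cast this
  have hlim : Tendsto (fun n : ℕ => (n : ℝ) * ‖2 * Real.pi * Complex.I / l‖ +
      -‖Complex.log w / l‖) atTop atTop :=
    tendsto_atTop_add_const_right _ _
      (tendsto_natCast_atTop_atTop.atTop_mul_const (norm_pos_iff.2 hc))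
  obtain ⟨n₀, hn₀⟩ := (hlim.eventually_gt_atTop K).exists_forall_of_atTop
  refine infinite_of_injective_forall_mem
    (f := fun n : ℕ => Complex.log w / l + (n + n₀ : ℕ) * (2 * Real.pi * Complex.I / l))
    (fun n m hnm => by simpa using hinj hnm) fun n => ⟨?_, ?_⟩
  · have h1 : l * (Complex.log w / l + (n + n₀ : ℕ) * (2 * Real.pi * Complex.I / l)) =
        Complex.log w + (n + n₀ : ℕ) * (2 * Real.pi * Complex.I) := by
      field_simp
    rw [mem_ofPred_eq, h1, Complex.exp_add, Complex.exp_log hw, Complex.exp_nat_mul_two_pi_mul_I,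
      mul_one]
  · have h4 := norm_sub_le
      (Complex.log w / l + (n + n₀ : ℕ) * (2 * Real.pi * Complex.I / l)) (Complex.log w / l)
    rw [add_sub_cancel_left, norm_mul, Complex.norm_natCast] at h4
    have := hn₀ (n + n₀) (Nat.le_add_left _ _)
    linarith

lemma AccumulatesAtInfty.mono {S S' : Set ℂ} (h : AccumulatesAtInfty S) (hS : S ⊆ S') :
    AccumulatesAtInfty S' := fun K => (h K).mono fun _ hz => ⟨hS hz.1, hz.2⟩

/-- Over a critical point w with finite value, Ψ' vanishes at every z with exp(lz) = w but not
identically near z, so 1/Ψ' tends to ∞. -/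
lemma accumulatesAtInfty_poles (hl : l ≠ 0) (hD : D ≠ 0)
    (hW : derivative N * D - N * derivative D ≠ 0)
    (hΨ : ∀ z, Ψ z = pairMap N D (Complex.exp (l * z))) {w : ℂ} (hw : w ≠ 0)
    (hDw : D.eval w ≠ 0) (hd : deriv (fun w => N.eval w / D.eval w) w = 0) :
    AccumulatesAtInfty (poles (field Ψ)) := by
  have hWw : (derivative N * D - N * derivative D).eval w = 0 := by
    rw [((N.hasDerivAt w).fun_div (D.hasDerivAt w) hDw).deriv, div_eq_zero_iff,
      or_iff_left (pow_ne_zero 2 hDw)] at hd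
    simpa using hd
  refine (accumulatesAtInfty_exp_eq hl hw).mono fun z hz => ?_
  have hz' : Complex.exp (l * z) = w := hz
  rw [poles, mem_ofPred_eq, ← tendsto_cobounded_iff_meromorphicOrderAt_neg (meromorphicAt_field hΨ z)]
  have h1 : AnalyticAt ℂ (fun z => affine (Ψ z)) z := by
    rw [affine_eq hΨ]
    exact AnalyticAt.comp ((analyticAt_eval N _).fun_div (analyticAt_eval D _) (by rwa [hz']))
      (analyticAt_exp_mul l z)
  have h2 : deriv (fun z => affine (Ψ z)) z = 0 := by
    rw [(hasDerivAt_affine hΨ (by rwa [hz'])).deriv, hz', hWw, zero_div, zero_mul]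
  refine tendsto_inv₀_nhdsNE_zero.comp (tendsto_nhdsWithin_iff.2
    ⟨?_, eventually_deriv_affine_ne_zero hl hD hW hΨ z⟩)
  have h3 := h1.deriv.continuousAt.tendsto
  rw [h2] at h3
  exact h3.mono_left nhdsWithin_le_nhds

/-- On small circles g is itself a single-valued primitive. -/
lemma hasResidue_deriv_zero {g : ℂ → ℂ} {z : ℂ} (hg : MeromorphicAt g z) :
    HasResidue (deriv g) z 0 := by
  obtain ⟨δ, hδ, hball⟩ := Metric.eventually_nhds_iff_ball.1
    (eventually_nhdsWithin_iff.1 hg.eventually_analyticAt)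
  filter_upwards [Ioo_mem_nhdsGT hδ] with ε hε
  rw [circleIntegral.integral_eq_zero_of_hasDerivWithinAt' (f := g), mul_zero]
  intro v hv
  rw [abs_of_pos hε.1] at hv
  have hv' : dist v z = ε := hv
  refine (hball v ?_ ?_).differentiableAt.hasDerivAt.hasDerivWithinAt
  · rw [Metric.mem_ball, hv']
    exact hε.2
  · rintro rfl
    rw [dist_self] at hv'
    exact hε.1.ne hv'

/-- The exponential is locally biholomorphic, so Ψ has order -m at z; differentiation gives -m - 1
and inversion m + 1. -/
lemma accumulatesAtInfty_residueFreeZeros (hl : l ≠ 0)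
    (hΨ : ∀ z, Ψ z = pairMap N D (Complex.exp (l * z))) {w : ℂ} (hw : w ≠ 0) {m : ℕ} (hm : 1 ≤ m)
    (hord : meromorphicOrderAt (fun w => N.eval w / D.eval w) w = ((-(m : ℤ) : ℤ) : WithTop ℤ)) :
    AccumulatesAtInfty (residueFreeZeros (field Ψ) (m + 1)) := by
  refine (accumulatesAtInfty_exp_eq hl hw).mono fun z hz => ⟨?_, ?_⟩
  · have hz' : Complex.exp (l * z) = w := hz
    have h1 : meromorphicOrderAt (fun z => affine (Ψ z)) z = ((-(m : ℤ) : ℤ) : WithTop ℤ) := by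
      rw [affine_eq hΨ, meromorphicOrderAt_comp_of_deriv_ne_zero (analyticAt_exp_mul l z), hz', hord]
      rw [(hasDerivAt_exp_mul l z).deriv]
      exact mul_ne_zero (Complex.exp_ne_zero _) hl
    have h2 := meromorphicOrderAt_deriv_eq_sub_one
      (by rw [Int.cast_ne_zero]; omega) h1
    rw [field_eq_inv, meromorphicOrderAt_inv, h2, ← WithTop.LinearOrderedAddCommGroup.coe_neg]
    congr 1
    push_cast
    ring
  · have h1 : (fun ζ => (field Ψ ζ)⁻¹) = deriv fun z => affine (Ψ z) := by
      funext ζ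
      rw [field, inv_inv]
    rw [h1]
    exact hasResidue_deriv_zero (meromorphicAt_affine hΨ z)

lemma exists_meromorphicOrderAt_eq_neg (h : NonconstantPair N D) {w : ℂ} (hw : D.eval w = 0) :
    ∃ m : ℕ, 1 ≤ m ∧ meromorphicOrderAt (fun w => N.eval w / D.eval w) w =
      ((-(m : ℤ) : ℤ) : WithTop ℤ) := by
  have hneg : meromorphicOrderAt (fun w => N.eval w / D.eval w) w < 0 := by
    rw [← tendsto_cobounded_iff_meromorphicOrderAt_neg (meromorphicAt_eval_div N D w)]
    have h1 : ContinuousAt (fun w => D.eval w / N.eval w) w :=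
      D.continuous.continuousAt.div N.continuous.continuousAt (h.eval_ne_zero w hw)
    have h2 := h1.tendsto
    simp only [hw, zero_div] at h2
    have h3 : Tendsto (fun w => D.eval w / N.eval w) (𝓝[≠] w) (𝓝[≠] 0) := by
      refine tendsto_nhdsWithin_iff.2 ⟨h2.mono_left nhdsWithin_le_nhds, ?_⟩
      filter_upwards [eventually_eval_ne_zero h.denom_ne_zero w,
        (N.continuous.continuousAt.eventually_ne (h.eval_ne_zero w hw)).filter_mono
          nhdsWithin_le_nhds] with v hv hv'
      exact div_ne_zero hv hv'
    refine (tendsto_inv₀_nhdsNE_zero.comp h3).congr fun v => ?_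
    simp
  obtain ⟨n, hn⟩ := WithTop.ne_top_iff_exists.1 hneg.ne_top
  rw [← hn] at hneg ⊢
  have hn0 : n < 0 := by exact_mod_cast hneg
  refine ⟨n.natAbs, by omega, ?_⟩
  congr 1
  omega

lemma eval_eq_zero_of_meromorphicOrderAt_eq_neg {w : ℂ} {m : ℕ} (hm : 1 ≤ m)
    (hord : meromorphicOrderAt (fun w => N.eval w / D.eval w) w = ((-(m : ℤ) : ℤ) : WithTop ℤ)) :
    D.eval w = 0 := by
  by_contra hD
  have h1 := ((analyticAt_eval N w).fun_div (analyticAt_eval D w) hD).meromorphicOrderAt_nonneg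
  rw [hord] at h1
  have : (0 : ℤ) ≤ -(m : ℤ) := by exact_mod_cast h1
  omega

end VectorField

/-! ### The space of rational functions of a given degree -/

section Family

open Polynomial

variable {r : ℕ}

lemma coeff_coeffPoly (c : Fin (r + 1) → ℂ) (i : Fin (r + 1)) : (coeffPoly c).coeff i = c i := by
  simp [coeffPoly, coeff_monomial, Fin.val_inj]

lemma natDegree_coeffPoly_le (c : Fin (r + 1) → ℂ) : (coeffPoly c).natDegree ≤ r :=
  natDegree_sum_le_of_forall_le _ _ fun i _ => (natDegree_monomial_le _).trans (by omega)

lemma coeffPoly_coeff {p : ℂ[X]} (hp : p.natDegree ≤ r) :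
    coeffPoly (fun i : Fin (r + 1) => p.coeff i) = p := by
  ext n
  rcases le_or_gt n r with hn | hn
  · exact coeff_coeffPoly (fun i : Fin (r + 1) => p.coeff i) ⟨n, by omega⟩
  · rw [coeff_eq_zero_of_natDegree_lt ((natDegree_coeffPoly_le _).trans_lt hn),
      coeff_eq_zero_of_natDegree_lt (hp.trans_lt hn)]

lemma coeffPoly_add_smul (c d : Fin (r + 1) → ℂ) (s : ℂ) :
    coeffPoly (fun i => d i + s * c i) = coeffPoly d + coeffPoly c * C s := by
  ext n
  rcases le_or_gt n r with hn | hn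
  · have h1 := fun e : Fin (r + 1) → ℂ => coeff_coeffPoly e ⟨n, by omega⟩
    simp only at h1
    rw [coeff_add, coeff_mul_C, h1, h1, h1, mul_comm]
  · have h1 := fun e : Fin (r + 1) → ℂ =>
      coeff_eq_zero_of_natDegree_lt ((natDegree_coeffPoly_le e).trans_lt hn)
    rw [coeff_add, coeff_mul_C, h1, h1, h1, zero_mul, add_zero]

lemma exists_eq_num_mul (N : ℂ[X]) {D : ℂ[X]} (hD : D ≠ 0) {R : RatFunc ℂ}
    (hR : R = algebraMap ℂ[X] (RatFunc ℂ) N / algebraMap ℂ[X] (RatFunc ℂ) D) :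
    ∃ g : ℂ[X], g ≠ 0 ∧ N = R.num * g ∧ D = R.denom * g := by
  obtain ⟨g, hg⟩ : R.denom ∣ D := hR ▸ RatFunc.denom_div_dvd N D
  have hd := RatFunc.denom_ne_zero R
  refine ⟨g, fun h => hD (by rw [hg, h, mul_zero]), ?_, hg⟩
  have h1 := hR
  rw [← RatFunc.num_div_denom R, div_eq_div_iff (RatFunc.algebraMap_ne_zero hd)
    (RatFunc.algebraMap_ne_zero hD), ← map_mul, ← map_mul] at h1
  have h2 := RatFunc.algebraMap_injective ℂ h1
  rw [hg] at h2
  refine mul_right_cancel₀ hd ?_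
  rw [← h2]
  ring

/-- A pair of coefficient vectors represents a rational function of degree `r` if and only if the
two polynomials are coprime and one of them has degree `r`. -/
lemma mem_ratCoeffs_iff (hr : 1 ≤ r) (c : (Fin (r + 1) → ℂ) × (Fin (r + 1) → ℂ)) :
    (coeffPoly c.2 ≠ 0 ∧ ratDegree (coeffQuot c) = r) ↔
      IsCoprime (coeffPoly c.1) (coeffPoly c.2) ∧
        ((coeffPoly c.1).coeff r ≠ 0 ∨ (coeffPoly c.2).coeff r ≠ 0) := by
  have hN := natDegree_coeffPoly_le c.1
  have hD := natDegree_coeffPoly_le c.2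
  constructor
  · rintro ⟨h0, hdeg⟩
    obtain ⟨g, hg0, hg1, hg2⟩ := exists_eq_num_mul (coeffPoly c.1) h0 (R := coeffQuot c) rfl
    have hd0 := RatFunc.denom_ne_zero (coeffQuot c)
    have hgD := natDegree_mul hd0 hg0
    rw [← hg2] at hgD
    -- The reduced fraction already has degree r and both polynomials have degree at most r, so no
    -- room is left for the common factor g.
    have hg : g.natDegree = 0 ∧ (coeffPoly c.1 ≠ 0 ∧ (coeffPoly c.1).natDegree = r ∨
        (coeffPoly c.2).natDegree = r) := by
      rw [ratDegree] at hdeg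
      by_cases hn0 : (coeffQuot c).num = 0
      · rw [hn0, natDegree_zero] at hdeg
        omega
      · have hgN := natDegree_mul hn0 hg0
        rw [← hg1] at hgN
        have : coeffPoly c.1 ≠ 0 := hg1 ▸ mul_ne_zero hn0 hg0
        refine ⟨by omega, ?_⟩
        by_cases h : (coeffPoly c.2).natDegree = r
        · exact Or.inr h
        · exact Or.inl ⟨this, by omega⟩
    constructor
    · have hu : IsUnit g := by
        rw [eq_C_of_natDegree_eq_zero hg.1, isUnit_C, isUnit_iff_ne_zero]
        intro h
        apply hg0
        rw [eq_C_of_natDegree_eq_zero hg.1, h, C_0]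
      rw [hg1, hg2, isCoprime_mul_unit_right hu]
      exact RatFunc.isCoprime_num_denom _
    · rcases hg.2 with ⟨h1, h2⟩ | h2
      · left
        rwa [← leadingCoeff_ne_zero, leadingCoeff, h2] at h1
      · right
        rwa [← leadingCoeff_ne_zero, leadingCoeff, h2] at h0
  · rintro ⟨hc, hcoeff⟩
    have h0 : coeffPoly c.2 ≠ 0 := by
      intro h0
      rw [h0, isCoprime_zero_right] at hc
      rw [h0, coeff_zero, coeff_eq_zero_of_natDegree_lt] at hcoeff
      · simp at hcoeff
      · rw [natDegree_eq_zero_of_isUnit hc]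
        omega
    refine ⟨h0, ?_⟩
    obtain ⟨g, hg0, hg1, hg2⟩ := exists_eq_num_mul (coeffPoly c.1) h0 (R := coeffQuot c) rfl
    have hu : IsUnit g := hc.isUnit_of_dvd' (hg1 ▸ dvd_mul_left _ _) (hg2 ▸ dvd_mul_left _ _)
    obtain ⟨k, hk, rfl⟩ := isUnit_iff.1 hu
    have h1 : (coeffPoly c.1).natDegree = (coeffQuot c).num.natDegree := by
      conv_lhs => rw [hg1]
      rw [natDegree_mul_C hk.ne_zero]
    have h2 : (coeffPoly c.2).natDegree = (coeffQuot c).denom.natDegree := by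
      conv_lhs => rw [hg2]
      rw [natDegree_mul_C hk.ne_zero]
    rw [ratDegree, ← h1, ← h2]
    rcases hcoeff with h | h
    · have := le_natDegree_of_ne_zero h
      omega
    · have := le_natDegree_of_ne_zero h
      omega

/-- The rational function with given homogeneous coordinates. -/
def ofCoeffs (c : RatCoeffs r) : RatMaps r := ⟨coeffQuot c.1, c.2.2⟩

instance : TopologicalSpace (RatCoeffs r) := instTopologicalSpaceSubtype

lemma isQuotientMap_ofCoeffs (hs : Function.Surjective (ofCoeffs (r := r))) :
    IsQuotientMap (ofCoeffs (r := r)) := ⟨⟨rfl⟩, hs⟩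

lemma surjective_ofCoeffs : Function.Surjective (ofCoeffs (r := r)) := by
  intro R
  have hN : R.1.num.natDegree ≤ r := (le_max_left _ _).trans_eq R.2
  have hD : R.1.denom.natDegree ≤ r := (le_max_right _ _).trans_eq R.2
  have h1 : coeffQuot (r := r) (fun i => R.1.num.coeff i, fun i => R.1.denom.coeff i) = R.1 := by
    rw [coeffQuot, coeffPoly_coeff hN, coeffPoly_coeff hD, RatFunc.num_div_denom]
  refine ⟨⟨(fun i => R.1.num.coeff i, fun i => R.1.denom.coeff i), ?_, ?_⟩, Subtype.ext h1⟩
  · rw [coeffPoly_coeff hD]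
    exact RatFunc.denom_ne_zero _
  · rw [h1]
    exact R.2

/-- The values at 0 and ∞ are the ratios of the coefficients of degree 0 and of degree r; clearing
denominators leaves homogeneous conditions, which can be tested on any coefficient vector. -/
lemma mem_subfamily_zero_iff (R : RatMaps r) : R ∈ subfamily r 0 ↔
    R.1.denom.coeff 0 ≠ 0 ∧ R.1.denom.coeff r ≠ 0 ∧
      R.1.num.coeff 0 * R.1.denom.coeff r ≠ R.1.num.coeff r * R.1.denom.coeff 0 := by
  have h : R ∈ subfamily r 0 ↔ ratMap R.1 ((0 : ℂ) : Sphere) ≠ ratMap R.1 ∞ ∧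
    ratMap R.1 ((0 : ℂ) : Sphere) ≠ ∞ ∧ ratMap R.1 ∞ ≠ ∞ := Iff.rfl
  rw [h, ratMap_infty R.2, ratMap_coe, Ne, Ne, Ne, pairMap_eq_infty_iff, pairMap_eq_infty_iff,
    eval_zero_reflect, ← coeff_zero_eq_eval_zero]
  constructor
  · rintro ⟨h1, h2, h3⟩
    refine ⟨h2, h3, fun h4 => h1 ?_⟩
    rw [pairMap_of_eval_ne_zero, pairMap_of_eval_ne_zero, eval_zero_reflect, eval_zero_reflect,
      ← coeff_zero_eq_eval_zero, ← coeff_zero_eq_eval_zero, (div_eq_div_iff h2 h3).2 h4]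
    · rwa [eval_zero_reflect]
    · rwa [← coeff_zero_eq_eval_zero]
  · rintro ⟨h2, h3, h4⟩
    refine ⟨fun h1 => h4 ?_, h2, h3⟩
    rwa [pairMap_of_eval_ne_zero, pairMap_of_eval_ne_zero, eval_zero_reflect, eval_zero_reflect,
      ← coeff_zero_eq_eval_zero, ← coeff_zero_eq_eval_zero, OnePoint.coe_eq_coe,
      div_eq_div_iff h2 h3] at h1
    · rwa [eval_zero_reflect]
    · rwa [← coeff_zero_eq_eval_zero]

lemma ofCoeffs_mem_subfamily_zero_iff (hr : 1 ≤ r) (c : RatCoeffs r) :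
    ofCoeffs c ∈ subfamily r 0 ↔ c.1.2 0 ≠ 0 ∧ c.1.2 (Fin.last r) ≠ 0 ∧
      c.1.1 0 * c.1.2 (Fin.last r) ≠ c.1.1 (Fin.last r) * c.1.2 0 := by
  obtain ⟨g, hg0, hg1, hg2⟩ := exists_eq_num_mul (coeffPoly c.1.1) c.2.1 (R := (ofCoeffs c).1) rfl
  have hu : IsUnit g := ((mem_ratCoeffs_iff hr c.1).1 c.2).1.isUnit_of_dvd'
    (hg1 ▸ dvd_mul_left _ _) (hg2 ▸ dvd_mul_left _ _)
  obtain ⟨k, hk, rfl⟩ := isUnit_iff.1 hu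
  have hk0 : k ≠ 0 := hk.ne_zero
  have h1 := fun i : Fin (r + 1) => coeff_coeffPoly c.1.1 i
  have h2 := fun i : Fin (r + 1) => coeff_coeffPoly c.1.2 i
  rw [hg1] at h1
  rw [hg2] at h2
  simp only [coeff_mul_C] at h1 h2
  rw [mem_subfamily_zero_iff, ← h1, ← h1, ← h2, ← h2, Fin.val_last, Fin.val_zero]
  generalize (ofCoeffs c).1.num.coeff 0 = n₀
  generalize (ofCoeffs c).1.num.coeff r = n₁
  generalize (ofCoeffs c).1.denom.coeff 0 = d₀
  generalize (ofCoeffs c).1.denom.coeff r = d₁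
  have h3 : n₀ * k * (d₁ * k) = n₁ * k * (d₀ * k) ↔ n₀ * d₁ = n₁ * d₀ := by
    rw [show n₀ * k * (d₁ * k) = n₀ * d₁ * (k * k) by ring,
      show n₁ * k * (d₀ * k) = n₁ * d₀ * (k * k) by ring,
      mul_left_inj' (mul_ne_zero hk0 hk0)]
  simp [hk0, h3]

lemma continuous_numCoeff (i : Fin (r + 1)) : Continuous fun c : RatCoeffs r => c.1.1 i :=
  (continuous_apply i).comp (continuous_fst.comp continuous_subtype_val)

lemma continuous_denomCoeff (i : Fin (r + 1)) : Continuous fun c : RatCoeffs r => c.1.2 i :=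
  (continuous_apply i).comp (continuous_snd.comp continuous_subtype_val)

lemma isOpen_subfamily_zero (hr : 1 ≤ r) : IsOpen (subfamily r 0) := by
  rw [← (isQuotientMap_ofCoeffs surjective_ofCoeffs).isOpen_preimage]
  have h1 : ofCoeffs ⁻¹' subfamily r 0 = {c : RatCoeffs r | c.1.2 0 ≠ 0} ∩
      ({c | c.1.2 (Fin.last r) ≠ 0} ∩
        {c | c.1.1 0 * c.1.2 (Fin.last r) ≠ c.1.1 (Fin.last r) * c.1.2 0}) := by
    ext c
    exact ofCoeffs_mem_subfamily_zero_iff hr c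
  rw [h1]
  have hn := fun i => continuous_numCoeff (r := r) i
  have hd := fun i => continuous_denomCoeff (r := r) i
  exact (isOpen_ne_fun (hd _) continuous_const).inter
    ((isOpen_ne_fun (hd _) continuous_const).inter
      (isOpen_ne_fun ((hn _).mul (hd _)) ((hn _).mul (hd _))))

/-! ### Density of the generic subfamily -/

lemma coeff_taylor_of_natDegree_le {p : ℂ[X]} (hp : p.natDegree ≤ r) (t : ℂ) :
    (taylor t p).coeff r = p.coeff r := by
  rcases hp.eq_or_lt with h | h
  · rw [← h, coeff_taylor_natDegree, leadingCoeff]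
  · rw [coeff_eq_zero_of_natDegree_lt h, coeff_eq_zero_of_natDegree_lt (by rwa [natDegree_taylor])]

lemma isCoprime_taylor {p q : ℂ[X]} (h : IsCoprime p q) (t : ℂ) :
    IsCoprime (taylor t p) (taylor t q) := by
  obtain ⟨a, b, hab⟩ := h
  exact ⟨taylor t a, taylor t b, by rw [← taylor_mul, ← taylor_mul, ← map_add, hab, taylor_one, C_1]⟩

lemma eventually_add_mul_ne_zero {x y : ℂ} (h : y ≠ 0 ∨ x ≠ 0) : ∀ᶠ s in 𝓝[≠] (0 : ℂ), y + s * x ≠ 0 := by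
  by_cases hy : y = 0
  · filter_upwards [self_mem_nhdsWithin] with s hs
    rw [hy, zero_add]
    exact mul_ne_zero hs (h.resolve_left (not_not.2 hy))
  · have h1 : ContinuousAt (fun s : ℂ => y + s * x) 0 := by fun_prop
    exact (h1.eventually_ne (by simpa using hy)).filter_mono nhdsWithin_le_nhds

lemma mem_closure_of_curve {X : Type*} [TopologicalSpace X] {γ : ℂ → X} (hγ : Continuous γ)
    {A : Set X} (hA : ∀ᶠ t in 𝓝[≠] (0 : ℂ), γ t ∈ A) : γ 0 ∈ closure A :=
  mem_closure_of_tendsto ((hγ.tendsto 0).mono_left nhdsWithin_le_nhds) hA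

/-- Translations make the values at `0` and `∞` different. -/
lemma mem_closure_of_translation (hr : 1 ≤ r) (c : RatCoeffs r) : c ∈ closure
    {c : RatCoeffs r | c.1.1 0 * c.1.2 (Fin.last r) ≠ c.1.1 (Fin.last r) * c.1.2 0} := by
  set N := coeffPoly c.1.1 with hNdef
  set D := coeffPoly c.1.2 with hDdef
  obtain ⟨hcop, hcoeff⟩ := (mem_ratCoeffs_iff hr c.1).1 c.2
  rw [← hNdef, ← hDdef] at hcop hcoeff
  have hN : N.natDegree ≤ r := natDegree_coeffPoly_le _
  have hD : D.natDegree ≤ r := natDegree_coeffPoly_le _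
  have hN' : ∀ t, (taylor t N).natDegree ≤ r := fun t => by rwa [natDegree_taylor]
  have hD' : ∀ t, (taylor t D).natDegree ≤ r := fun t => by rwa [natDegree_taylor]
  have hpair : NonconstantPair N D := by
    refine nonconstantPair_of_isCoprime hcop (hr.trans ?_)
    rcases hcoeff with h | h
    · exact (le_natDegree_of_ne_zero h).trans (le_max_left _ _)
    · exact (le_natDegree_of_ne_zero h).trans (le_max_right _ _)
  -- The curve R(w + t): translation preserves coprimality and the coefficients of degree r.
  let γ : ℂ → RatCoeffs r := fun t =>
    ⟨(fun i => (taylor t N).coeff i, fun i => (taylor t D).coeff i), by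
      rw [mem_ratCoeffs_iff hr]
      simp only [coeffPoly_coeff (hN' t), coeffPoly_coeff (hD' t),
        coeff_taylor_of_natDegree_le hN, coeff_taylor_of_natDegree_le hD]
      exact ⟨isCoprime_taylor hcop t, hcoeff⟩⟩
  have hγ : Continuous γ := by
    refine Continuous.subtype_mk (Continuous.prodMk (continuous_pi fun i => ?_)
      (continuous_pi fun i => ?_)) _ <;>
    · simp only [taylor_coeff]
      exact Polynomial.continuous _
  have hγ0 : γ 0 = c := by
    refine Subtype.ext (Prod.ext (funext fun i => ?_) (funext fun i => ?_))
    · simp only [γ, taylor_zero]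
      exact coeff_coeffPoly _ i
    · simp only [γ, taylor_zero]
      exact coeff_coeffPoly _ i
  rw [← hγ0]
  refine mem_closure_of_curve hγ ?_
  -- The constant coefficients of the translates are N(t) and D(t), so the condition to reach is
  -- that this polynomial does not vanish at t.
  have hp : N * C (D.coeff r) - C (N.coeff r) * D ≠ 0 := by
    by_cases h : D.coeff r = 0
    · have h1 := hcoeff.resolve_right (not_not.2 h)
      rw [h, C_0, mul_zero, zero_sub]
      exact neg_ne_zero.2 (mul_ne_zero (C_ne_zero.2 h1) hpair.denom_ne_zero)
    · have h1 : N * C (D.coeff r) - C (N.coeff r) * D =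
          C (D.coeff r) * (N - C (N.coeff r / D.coeff r) * D) := by
        rw [mul_sub, ← mul_assoc, ← C_mul, mul_div_cancel₀ _ h, mul_comm N]
      rw [h1]
      exact mul_ne_zero (C_ne_zero.2 h) (hpair.sub_ne_zero _)
  filter_upwards [eventually_eval_ne_zero hp 0] with t ht
  rw [eval_sub, eval_mul, eval_mul, eval_C, eval_C, sub_ne_zero] at ht
  simpa [γ, taylor_coeff_zero, coeff_taylor_of_natDegree_le hN,
    coeff_taylor_of_natDegree_le hD] using ht

/-- Möbius transformations of the values make the values at `0` and `∞` finite. -/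
lemma mem_closure_of_ne (hr : 1 ≤ r) {c : RatCoeffs r}
    (hc : c.1.1 0 * c.1.2 (Fin.last r) ≠ c.1.1 (Fin.last r) * c.1.2 0) :
    c ∈ closure (ofCoeffs ⁻¹' subfamily r 0) := by
  obtain ⟨hcop, hcoeff⟩ := (mem_ratCoeffs_iff hr c.1).1 c.2
  -- The curve N/(D + sN) = R/(1 + sR). It leaves the determinant in `hc` unchanged, so the values
  -- at 0 and ∞ stay different.
  let γ : ℂ → RatCoeffs r := fun s => ⟨(c.1.1, fun i => c.1.2 i + s * c.1.1 i), by
    rw [mem_ratCoeffs_iff hr]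
    simp only [coeffPoly_add_smul]
    refine ⟨hcop.add_mul_left_right _, ?_⟩
    by_cases h : (coeffPoly c.1.1).coeff r = 0
    · right
      rw [coeff_add, coeff_mul_C, h, zero_mul, add_zero]
      exact hcoeff.resolve_left (not_not.2 h)
    · exact Or.inl h⟩
  have hγ : Continuous γ := by
    refine Continuous.subtype_mk (Continuous.prodMk continuous_const (continuous_pi fun i => ?_)) _
    fun_prop
  have hγ0 : γ 0 = c := by
    refine Subtype.ext (Prod.ext rfl (funext fun i => ?_))
    simp [γ]
  have h0 : c.1.2 0 ≠ 0 ∨ c.1.1 0 ≠ 0 := by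
    by_contra! h
    exact hc (by rw [h.1, h.2, zero_mul, mul_zero])
  have h1 : c.1.2 (Fin.last r) ≠ 0 ∨ c.1.1 (Fin.last r) ≠ 0 := by
    by_contra! h
    exact hc (by rw [h.1, h.2, zero_mul, mul_zero])
  rw [← hγ0]
  refine mem_closure_of_curve hγ ?_
  filter_upwards [eventually_add_mul_ne_zero h0, eventually_add_mul_ne_zero h1] with s hs0 hs1
  rw [mem_preimage, ofCoeffs_mem_subfamily_zero_iff hr]
  refine ⟨hs0, hs1, fun h => hc ?_⟩
  simp only [γ] at h
  linear_combination h

lemma dense_subfamily_zero (hr : 1 ≤ r) : Dense (subfamily r 0) := by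
  have h1 : Dense (ofCoeffs ⁻¹' subfamily r 0) := by
    intro c
    refine closure_minimal (fun c hc => mem_closure_of_ne hr hc) isClosed_closure
      (mem_closure_of_translation hr c)
  have h2 := surjective_ofCoeffs.denseRange.dense_image
    (isQuotientMap_ofCoeffs surjective_ofCoeffs).continuous h1
  exact h2.mono (image_preimage_subset _ _)

lemma iUnion_subfamily (r : ℕ) : (⋃ j, subfamily r j) = univ := by
  refine eq_univ_of_forall fun R => mem_iUnion.2 ?_
  by_cases h0 : ratMap R.1 ((0 : ℂ) : Sphere) = ∞ <;> by_cases h1 : ratMap R.1 ∞ = ∞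
  · exact ⟨3, h0, h1⟩
  · exact ⟨2, Or.inr ⟨h0, h1⟩⟩
  · exact ⟨2, Or.inl ⟨h0, h1⟩⟩
  · by_cases h : ratMap R.1 ((0 : ℂ) : Sphere) = ratMap R.1 ∞
    · exact ⟨1, h, h1⟩
    · exact ⟨0, h, h0, h1⟩

lemma Configuration.unique {a₀ a₁ : Sphere} {i j : Fin 4} (hi : Configuration a₀ a₁ i)
    (hj : Configuration a₀ a₁ j) : i = j := by
  fin_cases i <;> fin_cases j <;> simp [Configuration] at hi hj ⊢ <;> grind

lemma disjoint_subfamily (r : ℕ) {i j : Fin 4} (h : i ≠ j) :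
    Disjoint (subfamily r i) (subfamily r j) :=
  Set.disjoint_left.2 fun _ hi hj => h (Configuration.unique hi hj)

end Family

/-! ### Rational functions of the exponential -/

lemma psi_eq_pairMap (R : RatFunc ℂ) (T z : ℂ) :
    psi R T z = pairMap R.num R.denom (Complex.exp (2 * Real.pi * Complex.I / T * z)) := by
  rw [psi_apply, mul_div_right_comm]

lemma cylinderMap_psi {r : ℕ} (hr : 1 ≤ r) {T : ℂ} (hT : T ≠ 0) {R : RatFunc ℂ}
    (hR : ratDegree R = r) :
    CylinderMap (psi R T) (2 * Real.pi * Complex.I / T) R.num R.denom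
      (R.num.reflect r) (R.denom.reflect r) := by
  have hpair := nonconstantPair_num_denom hr hR
  refine ⟨div_ne_zero Complex.two_pi_I_ne_zero hT, hpair, hpair.reflect hR, psi_eq_pairMap R T,
    fun z => ?_⟩
  rw [psi_eq_pairMap, neg_mul, Complex.exp_neg,
    pairMap_reflect_inv (hR ▸ le_max_left _ _) (hR ▸ le_max_right _ _) (Complex.exp_ne_zero _)]

lemma periodic_psi {T : ℂ} (hT : T ≠ 0) (R : RatFunc ℂ) : Function.Periodic (psi R T) T := by
  intro z
  rw [psi_eq_pairMap, psi_eq_pairMap, mul_add, div_mul_cancel₀ _ hT, Complex.exp_add,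
    Complex.exp_two_pi_mul_I, mul_one]

/-- A finite value at ∞ means that the denominator has degree r ≥ 1. -/
lemma exists_eval_denom_eq_zero {r : ℕ} (hr : 1 ≤ r) {R : RatFunc ℂ} (hR : ratDegree R = r)
    (h : ratMap R ∞ ≠ ∞) : ∃ w, R.denom.eval w = 0 := by
  rw [ratMap_infty hR, Ne, pairMap_eq_infty_iff, eval_zero_reflect] at h
  have hdeg := Polynomial.le_natDegree_of_ne_zero h
  refine Complex.exists_root (Polynomial.natDegree_pos_iff_degree_pos.1 (by omega))

end PeriodicFields

end

open PeriodicFields in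
theorem mainTheorem4 (r : ℕ) (hr : 1 ≤ r) (T : ℂ) (hT : T ≠ 0) :
    (∀ R : RatMaps r, ∀ Ψ : ℂ → Sphere, Ψ = psi R.1 T →
      ∀ f : ℂ → ℂ, f = field Ψ → ∀ a₀ : Sphere, a₀ = ratMap R.1 ((0 : ℂ) : Sphere) →
      ∀ a₁ : Sphere, a₁ = ratMap R.1 ∞ →
      -- the vector field is periodic with a unique essential singularity, at infinity
      (Function.Periodic f T ∧ {p : Sphere | IsEssentialSingularity f p} = {∞}) ∧
      -- exactly two asymptotic values, counted with multiplicity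
      ({a : Sphere | IsAsymptoticValue Ψ a} = {a₀, a₁} ∧
        ∃ U₀ U₁ : Ioi (0 : ℝ) → Set ℂ, U₀ ≠ U₁ ∧
          {s : Sphere × (Ioi (0 : ℝ) → Set ℂ) | IsTranscendentalSingularity Ψ s.1 s.2} =
            {(a₀, U₀), (a₁, U₁)}) ∧
      -- both singularities are logarithmic, with hyperbolic or elliptic tracts
      (∀ (a : Sphere) (U : Ioi (0 : ℝ) → Set ℂ), IsTranscendentalSingularity Ψ a U →
        IsLogarithmic Ψ a U ∧
        (∀ b : ℂ, a = (b : Sphere) → HasHyperbolicTracts b U f) ∧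
        (a = ∞ → HasEllipticTracts U f)) ∧
      -- poles of the vector field
      ((∃ w : ℂ, w ≠ 0 ∧ IsCriticalPoint (fun ζ : ℂ => ratMap R.1 (ζ : Sphere)) w ∧
          ratMap R.1 (w : Sphere) ≠ ∞) → AccumulatesAtInfty (poles f)) ∧
      -- zeros of the vector field
      (¬ IsAsymptoticValue Ψ ∞ →
        (∃ k : ℕ, 2 ≤ k ∧ AccumulatesAtInfty (residueFreeZeros f k)) ∧
        ∀ (w : ℂ) (m : ℕ), 1 ≤ m →
          meromorphicOrderAt (fun ζ : ℂ => affine (ratMap R.1 (ζ : Sphere))) w =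
            ((-(m : ℤ) : ℤ) : WithTop ℤ) →
          AccumulatesAtInfty (residueFreeZeros f (m + 1)))) ∧
    -- the four subfamilies, the first of which is generic
    ((⋃ j, subfamily r j) = univ ∧ (∀ i j, i ≠ j → Disjoint (subfamily r i) (subfamily r j)) ∧
      IsOpen (subfamily r 0) ∧ Dense (subfamily r 0)) := by
  refine ⟨?_, iUnion_subfamily r, fun i j h => disjoint_subfamily r h, isOpen_subfamily_zero hr,
    dense_subfamily_zero hr⟩
  rintro ⟨R, hR⟩ _ rfl _ rfl _ rfl _ rfl
  have S := cylinderMap_psi hr hT hR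
  have hW := derivative_mul_sub_ne_zero (RatFunc.isCoprime_num_denom R) (hr.trans_eq hR.symm)
  have hasymp := S.setOf_isAsymptoticValue
  rw [← ratMap_infty hR, ← ratMap_coe] at hasymp
  obtain ⟨hex, htracts⟩ := S.exists_transcendentalSingularities
  rw [← ratMap_infty hR, ← ratMap_coe] at hex
  have haff : (fun ζ : ℂ => affine (ratMap R (ζ : Sphere))) =
      fun ζ => R.num.eval ζ / R.denom.eval ζ := funext fun ζ => affine_pairMap ζ
  refine ⟨⟨periodic_field (periodic_psi hT R), setOf_isEssentialSingularity_field hT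
    (periodic_psi hT R) S.ne_zero S.pair.denom_ne_zero hW S.apply_eq⟩, ⟨hasymp, hex⟩,
    fun a U hU => ?_, ?_, fun hinf => ?_⟩
  · obtain ⟨φ, H, M, E, ρ₀, hgood, hUeq⟩ := htracts a U hU
    exact E.isLogarithmic_and_tracts hU.2.1 hgood hUeq
  · rintro ⟨w, hw, hcrit, hfin⟩
    have hDw : R.denom.eval w ≠ 0 := fun h => hfin (pairMap_eq_infty_iff.2 h)
    refine accumulatesAtInfty_poles S.ne_zero S.pair.denom_ne_zero hW S.apply_eq hw hDw ?_
    rcases hcrit with ⟨-, h⟩ | ⟨h, -⟩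
    · rwa [haff] at h
    · exact absurd h hfin
  · have h0 : ratMap R ((0 : ℂ) : Sphere) ≠ ∞ := fun h =>
      hinf (hasymp.symm.subset (Or.inl h.symm))
    have h1 : ratMap R ∞ ≠ ∞ := fun h => hinf (hasymp.symm.subset (Or.inr h.symm))
    have hpole : ∀ (w : ℂ) (m : ℕ), 1 ≤ m →
        meromorphicOrderAt (fun ζ => R.num.eval ζ / R.denom.eval ζ) w =
          ((-(m : ℤ) : ℤ) : WithTop ℤ) →
        AccumulatesAtInfty (residueFreeZeros (field (psi R T)) (m + 1)) := by
      intro w m hm hord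
      refine accumulatesAtInfty_residueFreeZeros S.ne_zero S.apply_eq ?_ hm hord
      -- The fibre of the exponential over w needs w ≠ 0: a pole at 0 would make a₀ = ∞ an
      -- asymptotic value.
      rintro rfl
      exact h0 (pairMap_eq_infty_iff.2 (eval_eq_zero_of_meromorphicOrderAt_eq_neg hm hord))
    rw [haff]
    refine ⟨?_, hpole⟩
    obtain ⟨w, hw⟩ := exists_eval_denom_eq_zero hr hR h1
    obtain ⟨m, hm, hord⟩ := exists_meromorphicOrderAt_eq_neg S.pair hw
    exact ⟨m + 1, by omega, hpole w m hm hord⟩
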